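/- Let $\omega=\{1,2,\dots\}$, let $\mathcal M$ be the monoid of injective self-maps of $\omega$, and let $E\mathcal M$ be the strict monoidal category with object set $\mathcal M$ and exactly one morphism between any two objects. A finite subgroup $G\subset\mathcal M$ is called universal if every finite $G$-set embeds $G$-equivariantly into $\omega$. A parsummable category is a small category $\mathcal C$ with a strict $E\mathcal M$-action in which every object is finitely supported, together with a zero object and a strictly unital, associative and commutative, functorial and $E\mathcal M$-equivariant sum operation, defined on disjointly supported objects and on morphisms between such pairs. Let $\mathbf{ParSumCat}$ be the category of parsummable categories and of functors that strictly preserve this structure. For a category $\mathcal C$ let $\pi_0(\mathcal C)$ be its set of objects modulo zig-zags of morphisms. If $\mathcal C$ is parsummable and $G$ is universal, then $\pi_0(\mathcal C)$ and $\pi_0(\mathcal C^G)$, where $\mathcal C^G$ is the category of $G$-fixed objects and $G$-fixed morphisms, are commutative monoids under the sum of disjointly supported representatives. For a permutative category $\mathscr D$, $\pi_0(\mathscr D)$ is a commutative monoid under $\otimes$. For a small permutative category $\mathscr D$ (a symmetric monoidal category whose associativity and unitality isomorphisms are identities) with unit $\mathbf 1$, let $\Phi\mathscr D$ be the parsummable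 category whose objects are the sequences $X_\bullet=(X_1,X_2,\dots)$ in $\mathscr D$ with $X_i=\mathbf 1$ for almost all $i$, and with $\mathrm{Hom}(X_\bullet,Y_\bullet)=\mathrm{Hom}_{\mathscr D}(\bigotimes_i X_i,\bigotimes_i Y_i)$. Here $u\in\mathcal M$ acts by $(u_*X)_{u(j)}=X_j$ and $(u_*X)_i=\mathbf 1$ for $i\notin\operatorname{im}(u)$, the structure isomorphism $X_\bullet\to u_*X_\bullet$ is the coherence isomorphism that moves the factor $X_i$ to position $u(i)$, the sum is given on objects by $(X+Y)_i=X_i$ if $X_i\neq\mathbf 1$ and $(X+Y)_i=Y_i$ otherwise, and on morphisms by conjugating $f\otimes g$ with the coherence isomorphisms $\bigotimes_i(X+Y)_i\cong\bigotimes_iX_i\otimes\bigotimes_iY_i$. For $X\in\mathscr D$ and finite $S\subset\omega$ let $\Pi(X,S)\in\Phi\mathscr D$ have entries $X$ at the positions in $S$ and $\mathbf 1$ elsewhere. Then the following hold. 1. There is no small permutative category $\mathscr D$ for which there are isomorphisms of monoids $\pi_0(\Phi\mathscr D)\cong\mathbb N$ and $\pi_0\big((\Phi\mathscr D)^{\mathbb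 Z/3}\big)\cong\mathbb N^3$, where $\mathbb Z/3$ is identified with any universal subgroup of $\mathcal M$ isomorphic to it. 2. For every small permutative category $\mathscr D$ and every universal $G\subset\mathcal M$ there is a unique monoid homomorphism $$a_G\colon\prod_{\text{isom. classes of transitive }G\text{-sets}}\pi_0(\mathscr D)\longrightarrow\pi_0\big((\Phi\mathscr D)^G\big)$$ which on the factor of the class of a transitive $G$-set $T$ sends $[X]$ to $[\Pi(X,S)]$ for every $G$-subset $S\subset\omega$ isomorphic to $T$. It is surjective, and it is bijective if $G$ is the trivial group. 3. Call a morphism $F\colon\mathcal C\to\mathcal C'$ in $\mathbf{ParSumCat}$ a global weak equivalence if $F^G\colon\mathcal C^G\to\mathcal C'^G$ induces a homotopy equivalence of classifying spaces for every universal $G\subset\mathcal M$. Then $\Phi$ is not essentially surjective after localizing $\mathbf{ParSumCat}$ at the global weak equivalences: there is a parsummable category that is not isomorphic, in the ($1$-categorical) localization, to $\Phi\mathscr D$ for any small permutative category $\mathscr D$. -/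

import Mathlib

open CategoryTheory MonoidalCategory

set_option linter.unusedSectionVars false

universe u v

namespace ParSum

/-- The countable set `ω = {1, 2, …}`. -/
abbrev Omega : Type := ℕ+

/-! ### Coherence isomorphisms in a symmetric monoidal category -/

section Coherence

variable {D : Type u} [Category.{v} D]

/-- Formal tensor products of objects of `D`; every factor carries a label in `ω`. -/
inductive Formal (D : Type u) : Type u
  | unit : Formal D
  | leaf (i : Omega) (x : D) : Formal D
  | tensor (a b : Formal D) : Formal D

namespace Formal

/-- The labels of a formal tensor product, in order. -/
def labels : Formal D → List Omega
  | unit => []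
  | leaf i _ => [i]
  | tensor a b => a.labels ++ b.labels

/-- The labelled factors of a formal tensor product, in order. -/
def leaves : Formal D → List (Omega × D)
  | unit => []
  | leaf i x => [(i, x)]
  | tensor a b => a.leaves ++ b.leaves

/-- The formal tensor product `p₁ ⊗ (p₂ ⊗ (⋯ ⊗ (pₙ ⊗ 𝟙)))` of a list. -/
def ofList : List (Omega × D) → Formal D
  | [] => unit
  | p :: l => tensor (leaf p.1 p.2) (ofList l)

theorem labels_eq (e : Formal D) : e.labels = e.leaves.map Prod.fst := by
  induction e with
  | unit => rfl
  | leaf => rfl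
  | tensor a b iha ihb => simp [labels, leaves, iha, ihb]

theorem leaves_ofList (l : List (Omega × D)) : (ofList l).leaves = l := by
  induction l with
  | nil => rfl
  | cons p l ih => simp [ofList, leaves, ih]

variable [MonoidalCategory D]

/-- The object of `D` denoted by a formal tensor product. -/
@[reducible]
def eval : Formal D → D
  | unit => 𝟙_ D
  | leaf _ x => x
  | tensor a b => a.eval ⊗ b.eval

end Formal

variable [MonoidalCategory D] [SymmetricCategory D]

open Formal

/-- `Coh u e e' f` says that `f` is a composite of tensor products of associativity, unitality and
symmetry isomorphisms that moves the factor with label `i` in `e` to the factor with label `u i`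
in `e'`. -/
inductive Coh : (Omega → Omega) → (e e' : Formal D) → (e.eval ⟶ e'.eval) → Prop
  | unit (u : Omega → Omega) : Coh u unit unit (𝟙 _)
  | leaf (u : Omega → Omega) (i : Omega) (x : D) : Coh u (leaf i x) (leaf (u i) x) (𝟙 x)
  | tensor {u : Omega → Omega} {a a' b b' : Formal D} {f : a.eval ⟶ a'.eval}
      {g : b.eval ⟶ b'.eval} (hf : Coh u a a' f) (hg : Coh u b b' g) :
      Coh u (tensor a b) (tensor a' b') (f ⊗ₘ g)
  | assoc (a b c : Formal D) :
      Coh id (tensor (tensor a b) c) (tensor a (tensor b c)) (α_ a.eval b.eval c.eval).hom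
  | assoc_inv (a b c : Formal D) :
      Coh id (tensor a (tensor b c)) (tensor (tensor a b) c) (α_ a.eval b.eval c.eval).inv
  | left_unitor (a : Formal D) : Coh id (tensor unit a) a (λ_ a.eval).hom
  | left_unitor_inv (a : Formal D) : Coh id a (tensor unit a) (λ_ a.eval).inv
  | right_unitor (a : Formal D) : Coh id (tensor a unit) a (ρ_ a.eval).hom
  | right_unitor_inv (a : Formal D) : Coh id a (tensor a unit) (ρ_ a.eval).inv
  | braiding (a b : Formal D) : Coh id (tensor a b) (tensor b a) (β_ a.eval b.eval).hom
  | comp {u v : Omega → Omega} {a b c : Formal D} {f : a.eval ⟶ b.eval} {g : b.eval ⟶ c.eval}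
      (hf : Coh u a b f) (hg : Coh v b c g) : Coh (v ∘ u) a c (f ≫ g)
  | congr {u v : Omega → Omega} {a b : Formal D} {f : a.eval ⟶ b.eval}
      (h : ∀ i ∈ a.labels, u i = v i) (hf : Coh u a b f) : Coh v a b f

/-- Evaluation of a labelled list. -/
@[reducible]
def tensL : List (Omega × D) → D
  | [] => 𝟙_ D
  | p :: l => p.2 ⊗ tensL l

/-- A list together with a morphism from `B` to its tensor product. -/
structure St (B : D) where
  list : List (Omega × D)
  hom : B ⟶ tensL list

namespace St

theorem ext' {B : D} {s t : St B} (h : s.list = t.list)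
    (h' : s.hom ≫ eqToHom (congrArg tensL h) = t.hom) : s = t := by
  cases s; cases t; cases h; simp at h'; simp [h']

/-- Precomposition. -/
def pre {A B : D} (f : A ⟶ B) (s : St B) : St A := ⟨s.list, f ≫ s.hom⟩

/-- Tensoring with an object on the left. -/
def cons {B : D} (a : Omega) (x : D) (s : St B) : St (x ⊗ B) := ⟨(a, x) :: s.list, x ◁ s.hom⟩

theorem pre_pre {A B C : D} (f : A ⟶ B) (g : B ⟶ C) (s : St C) :
    pre f (pre g s) = pre (f ≫ g) s := by simp [pre]

theorem pre_id {A : D} (s : St A) : pre (𝟙 A) s = s := by simp [pre]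

theorem cons_pre {A B : D} (a : Omega) (x : D) (f : A ⟶ B) (s : St B) :
    cons a x (pre f s) = pre (x ◁ f) (cons a x s) := by
  simp only [pre, cons, whiskerLeft_comp]

end St

/-- The isomorphism exchanging the first two factors. -/
def swap (x y B : D) : x ⊗ (y ⊗ B) ⟶ y ⊗ (x ⊗ B) :=
  (α_ x y B).inv ≫ (β_ x y).hom ▷ B ≫ (α_ y x B).hom

theorem swap_natural (x y : D) {A B : D} (f : A ⟶ B) :
    x ◁ y ◁ f ≫ swap x y B = swap x y A ≫ y ◁ x ◁ f := by
  simp only [swap, Category.assoc]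
  rw [← associator_naturality_right, ← whisker_exchange_assoc,
    ← associator_inv_naturality_right_assoc]

theorem swap_natural_left {x x' : D} (f : x ⟶ x') (y B : D) :
    f ▷ (y ⊗ B) ≫ swap x' y B = swap x y B ≫ y ◁ (f ▷ B) := by
  simp only [swap, Category.assoc]
  rw [← associator_naturality_middle, ← comp_whiskerRight_assoc,
    ← BraidedCategory.braiding_naturality_left, comp_whiskerRight_assoc,
    associator_inv_naturality_left_assoc]

theorem swap_swap (x y B : D) : swap x y B ≫ swap y x B = 𝟙 _ := by
  simp [swap, ← comp_whiskerRight_assoc]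

theorem swap_tensor (x x' y B : D) :
    (α_ x x' (y ⊗ B)).hom ≫ x ◁ swap x' y B ≫ swap x y (x' ⊗ B) =
      swap (x ⊗ x') y B ≫ y ◁ (α_ x x' B).hom := by
  simp only [swap, BraidedCategory.braiding_tensor_left_hom]
  monoidal

theorem swap_unit (y B : D) : swap (𝟙_ D) y B ≫ y ◁ (λ_ B).hom = (λ_ (y ⊗ B)).hom := by
  simp only [swap, braiding_tensorUnit_left]
  monoidal

theorem swap_tensor' (x x' y B : D) :
    x ◁ swap x' y B ≫ swap x y (x' ⊗ B) =
      (α_ x x' (y ⊗ B)).inv ≫ swap (x ⊗ x') y B ≫ y ◁ (α_ x x' B).hom := by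
  rw [← swap_tensor]; simp

theorem swap_yb (x y z B : D) :
    x ◁ swap y z B ≫ swap x z (y ⊗ B) ≫ z ◁ swap x y B =
      swap x y (z ⊗ B) ≫ y ◁ swap x z B ≫ swap y z (x ⊗ B) := by
  rw [swap_tensor' y x z B, reassoc_of% (swap_tensor' x y z B)]
  have h := swap_natural_left (β_ x y).hom z B
  have e (C : D) : swap x y C = (α_ x y C).inv ≫ (β_ x y).hom ▷ C ≫ (α_ y x C).hom := rfl
  simp only [e, Category.assoc, Iso.hom_inv_id_assoc, ← whiskerLeft_comp]
  rw [reassoc_of% h]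
  simp

/-- Insertion of a labelled object into a list, before the first label that is not smaller. -/
def insL (a : Omega) (x : D) : (L : List (Omega × D)) → St (x ⊗ tensL L)
  | [] => ⟨[(a, x)], 𝟙 _⟩
  | (b, y) :: L =>
    if a ≤ b then ⟨(a, x) :: (b, y) :: L, 𝟙 _⟩
    else St.pre (swap x y (tensL L)) (St.cons b y (insL a x L))

theorem insL_of_le {a b : Omega} (h : a ≤ b) (x y : D) (L : List (Omega × D)) :
    insL a x ((b, y) :: L) = ⟨(a, x) :: (b, y) :: L, 𝟙 _⟩ := if_pos h

theorem insL_of_lt {a b : Omega} (h : b < a) (x y : D) (L : List (Omega × D)) :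
    insL a x ((b, y) :: L) = St.pre (swap x y (tensL L)) (St.cons b y (insL a x L)) :=
  if_neg (not_le.mpr h)

namespace St

/-- Insertion of a labelled object. -/
def ins {B : D} (a : Omega) (x : D) (s : St B) : St (x ⊗ B) := pre (x ◁ s.hom) (insL a x s.list)

theorem ins_pre {A B : D} (a : Omega) (x : D) (f : A ⟶ B) (s : St B) :
    ins a x (pre f s) = pre (x ◁ f) (ins a x s) := by
  simp only [ins, pre, whiskerLeft_comp, Category.assoc]

theorem ins_cons_of_le {B : D} {a b : Omega} (h : a ≤ b) (x y : D) (s : St B) :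
    ins a x (cons b y s) = cons a x (cons b y s) := by
  change pre (x ◁ y ◁ s.hom) (insL a x ((b, y) :: s.list)) = _
  rw [insL_of_le h]
  simp only [cons, pre, Category.comp_id]

theorem ins_cons_of_lt {B : D} {a b : Omega} (h : b < a) (x y : D) (s : St B) :
    ins a x (cons b y s) = pre (swap x y B) (cons b y (ins a x s)) := by
  change pre (x ◁ y ◁ s.hom) (insL a x ((b, y) :: s.list)) = _
  rw [insL_of_lt h, pre_pre, swap_natural, ← pre_pre]
  simp only [ins, cons, pre, whiskerLeft_comp]

theorem eq_pre {B : D} (s : St B) : s = pre s.hom ⟨s.list, 𝟙 _⟩ := by simp [pre]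

theorem ins_nil (a : Omega) (x : D) :
    ins a x ⟨[], 𝟙 (𝟙_ D)⟩ = cons a x ⟨[], 𝟙 (𝟙_ D)⟩ := by
  simp only [ins, cons, insL, pre, tensL]
  congr 1
  exact Category.comp_id _

theorem ins_ins_lt {a b : Omega} (h : a < b) (x y : D) {B : D} (s : St B) :
    ins a x (ins b y s) = pre (swap x y B) (ins b y (ins a x s)) := by
  suffices H : ∀ L : List (Omega × D), ins a x (ins b y ⟨L, 𝟙 (tensL L)⟩) =
      pre (swap x y _) (ins b y (ins a x ⟨L, 𝟙 (tensL L)⟩)) by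
    rw [eq_pre s, ins_pre, ins_pre, H, ins_pre, ins_pre, pre_pre, pre_pre, swap_natural]
  intro L
  induction L with
  | nil =>
    change ins a x (ins b y ⟨[], 𝟙 (𝟙_ D)⟩) =
      pre (swap x y _) (ins b y (ins a x ⟨[], 𝟙 (𝟙_ D)⟩))
    rw [ins_nil, ins_nil, ins_cons_of_le h.le, ins_cons_of_lt h, pre_pre, swap_swap, pre_id,
      ins_nil]
  | cons p L ih =>
    obtain ⟨c, z⟩ := p
    have e : (⟨(c, z) :: L, 𝟙 (tensL ((c, z) :: L))⟩ : St (tensL ((c, z) :: L))) =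
        cons c z ⟨L, 𝟙 (tensL L)⟩ := by
      simp only [cons, whiskerLeft_id]
    rw [e]
    change ins a x (ins b y (cons c z ⟨L, 𝟙 (tensL L)⟩)) =
      pre (swap x y (z ⊗ tensL L)) (ins b y (ins a x (cons c z ⟨L, 𝟙 (tensL L)⟩)))
    rcases le_or_gt a c with hac | hac
    · rw [ins_cons_of_le hac, ins_cons_of_lt h, pre_pre, swap_swap, pre_id]
      rcases le_or_gt b c with hbc | hbc
      · rw [ins_cons_of_le hbc, ins_cons_of_le h.le]
      · rw [ins_cons_of_lt hbc, ins_pre, ins_cons_of_le hac, cons_pre]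
    · rw [ins_cons_of_lt hac, ins_cons_of_lt (hac.trans h), ins_pre, ins_pre, ins_cons_of_lt hac,
        ins_cons_of_lt (hac.trans h), ih, cons_pre, pre_pre, pre_pre, pre_pre, pre_pre,
        Category.assoc, Category.assoc, swap_yb]

theorem ins_ins {a b : Omega} (h : a ≠ b) (x y : D) {B : D} (s : St B) :
    ins a x (ins b y s) = pre (swap x y B) (ins b y (ins a x s)) := by
  rcases lt_or_gt_of_ne h with h | h
  · exact ins_ins_lt h x y s
  · rw [ins_ins_lt h y x s, pre_pre, swap_swap, pre_id]

/-- Insertion of all factors of a formal tensor product, relabelled along `v`. -/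
def act (v : Omega → Omega) : (e : Formal D) → {B : D} → St B → St (e.eval ⊗ B)
  | .unit, B, s => pre (λ_ B).hom s
  | .leaf i x, _, s => ins (v i) x s
  | .tensor a b, B, s => pre (α_ a.eval b.eval B).hom (act v a (act v b s))

theorem act_pre (v : Omega → Omega) (e : Formal D) {A B : D} (f : A ⟶ B) (s : St B) :
    act v e (pre f s) = pre (e.eval ◁ f) (act v e s) := by
  induction e generalizing A B with
  | unit => simp only [act, pre_pre, Formal.eval]; rw [leftUnitor_naturality]
  | leaf i x => exact ins_pre _ _ _ _
  | tensor a b iha ihb =>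
    simp only [act, iha, ihb, pre_pre, Formal.eval]
    congr 1
    simp

theorem act_ins (v : Omega → Omega) (e : Formal D) {a : Omega} (h : ∀ i ∈ e.labels, v i ≠ a)
    (x : D) {B : D} (s : St B) :
    act v e (ins a x s) = pre (swap e.eval x B) (ins a x (act v e s)) := by
  induction e generalizing B with
  | unit => simp only [act, ins_pre, pre_pre, Formal.eval]; rw [swap_unit]
  | leaf i y => exact ins_ins (h i (by simp [Formal.labels])) _ _ _
  | tensor p q ihp ihq =>
    simp only [Formal.labels, List.mem_append] at h
    simp only [act, Formal.eval, ins_pre, pre_pre]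
    rw [ihq (fun i hi => h i (Or.inr hi)), act_pre, ihp (fun i hi => h i (Or.inl hi)), pre_pre,
      pre_pre, Category.assoc, swap_tensor]

theorem act_act (v : Omega → Omega) (e e' : Formal D)
    (h : ∀ i ∈ e.labels, ∀ j ∈ e'.labels, v i ≠ v j) {B : D} (s : St B) :
    act v e (act v e' s) = pre (swap e.eval e'.eval B) (act v e' (act v e s)) := by
  induction e' generalizing B with
  | unit =>
    simp only [act, act_pre, pre_pre, Formal.eval]
    congr 1
    simp only [swap, braiding_tensorUnit_right]
    monoidal
  | leaf i y => exact act_ins v e (fun j hj => h j hj i (by simp [Formal.labels])) _ _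
  | tensor p q ihp ihq =>
    simp only [Formal.labels, List.mem_append] at h
    simp only [act, Formal.eval, act_pre, pre_pre]
    rw [ihp (fun i hi j hj => h i hi j (Or.inl hj)), ihq (fun i hi j hj => h i hi j (Or.inr hj)),
      act_pre, pre_pre, pre_pre]
    congr 1
    simp only [swap, BraidedCategory.braiding_tensor_right_hom]
    monoidal

theorem isIso_insL (a : Omega) (x : D) (L : List (Omega × D)) : IsIso (insL a x L).hom := by
  induction L with
  | nil => exact inferInstanceAs (IsIso (𝟙 (x ⊗ 𝟙_ D)))
  | cons p L ih =>
    obtain ⟨b, y⟩ := p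
    rcases le_or_gt a b with h | h
    · rw [insL_of_le h]; exact inferInstanceAs (IsIso (𝟙 (x ⊗ y ⊗ tensL L)))
    · rw [insL_of_lt h]
      simp only [pre, cons, swap]
      exact inferInstance

theorem isIso_act (v : Omega → Omega) (e : Formal D) {B : D} (s : St B) [IsIso s.hom] :
    IsIso (act v e s).hom := by
  induction e generalizing B with
  | unit => simp only [act, pre]; exact inferInstance
  | leaf i x =>
    have := isIso_insL (v i) x s.list
    simp only [act, ins, pre]; exact inferInstance
  | tensor a b iha ihb =>
    have := ihb s
    have := iha (act v b s)
    simp only [act, pre]; exact inferInstance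

theorem act_congr {u v : Omega → Omega} (e : Formal D) (h : ∀ i ∈ e.labels, u i = v i) {B : D}
    (s : St B) : act u e s = act v e s := by
  induction e generalizing B with
  | unit => rfl
  | leaf i x => simp only [act]; rw [h i (by simp [Formal.labels])]
  | tensor p q ihp ihq =>
    simp only [Formal.labels, List.mem_append] at h
    simp only [act]
    rw [ihq (fun i hi => h i (Or.inr hi)), ihp (fun i hi => h i (Or.inl hi))]

end St

namespace Coh

theorem leaves_perm {u : Omega → Omega} {e e' : Formal D} {f : e.eval ⟶ e'.eval}
    (h : Coh u e e' f) : e'.leaves.Perm (e.leaves.map (Prod.map u id)) := by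
  induction h with
  | unit => simp [Formal.leaves]
  | leaf => simp [Formal.leaves]
  | tensor _ _ hf hg => simpa [Formal.leaves] using hf.append hg
  | assoc | assoc_inv | left_unitor | left_unitor_inv | right_unitor | right_unitor_inv =>
    simp [Formal.leaves]
  | braiding a b => simpa [Formal.leaves] using List.perm_append_comm
  | comp _ _ hf hg =>
    refine hg.trans ?_
    simpa [Prod.map_comp_map] using hf.map (Prod.map _ id)
  | @congr u v a b f h _ hf =>
    refine hf.trans (List.Perm.of_eq (List.map_congr_left fun p hp => ?_))
    have := h p.1 (by rw [Formal.labels_eq]; exact List.mem_map_of_mem hp)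
    simp [Prod.map, this]

theorem labels_perm {u : Omega → Omega} {e e' : Formal D} {f : e.eval ⟶ e'.eval}
    (h : Coh u e e' f) : e'.labels.Perm (e.labels.map u) := by
  simpa [Formal.labels_eq, Function.comp_def] using h.leaves_perm.map Prod.fst

theorem pre_act {u : Omega → Omega} {e e' : Formal D} {f : e.eval ⟶ e'.eval}
    (h : Coh u e e' f) (v : Omega → Omega) (hv : (e'.labels.map v).Nodup) {B : D} (s : St B) :
    St.pre (f ▷ B) (St.act v e' s) = St.act (v ∘ u) e s := by
  induction h generalizing v B with
  | unit => simp only [id_whiskerRight]; exact St.pre_id _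
  | leaf => simp only [id_whiskerRight]; exact St.pre_id _
  | @tensor u a a' b b' f g _ _ hf hg =>
    simp only [Formal.labels, List.map_append] at hv
    simp only [St.act]
    rw [← hf v hv.of_append_left, ← hg v hv.of_append_right, St.act_pre, St.pre_pre, St.pre_pre,
      St.pre_pre]
    congr 1
    simp [MonoidalCategory.tensorHom_def]
  | assoc a b c =>
    simp only [St.act, St.pre_pre, St.act_pre]
    congr 1
    simp
  | assoc_inv a b c =>
    simp only [St.act, St.pre_pre, St.act_pre]
    congr 1
    simp
  | left_unitor a =>
    simp only [St.act, St.pre_pre]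
    congr 1
    simp
  | left_unitor_inv a =>
    simp only [St.act, St.pre_pre, Function.comp_id]
    refine Eq.trans ?_ (St.pre_id _)
    congr 1
    simp
  | right_unitor a =>
    simp only [St.act, St.act_pre, St.pre_pre]
    congr 1
    simp
  | right_unitor_inv a =>
    simp only [St.act, St.act_pre, St.pre_pre, Function.comp_id]
    refine Eq.trans ?_ (St.pre_id _)
    congr 1
    simp
  | braiding a b =>
    simp only [Formal.labels, List.map_append, List.nodup_append] at hv
    simp only [St.act, Function.comp_id]
    rw [St.act_act v a b, St.pre_pre, St.pre_pre]
    · congr 1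
      simp [swap]
    · intro i hi j hj e
      exact hv.2.2 _ (List.mem_map_of_mem hj) _ (List.mem_map_of_mem hi) e.symm
  | comp hf hg ihf ihg =>
    rw [comp_whiskerRight, ← St.pre_pre, ihg v hv, ihf]
    · rfl
    · have := (hg.labels_perm.map v).nodup_iff.mp hv
      simpa using this
  | congr h hf ih => rw [ih v hv]; exact St.act_congr _ (fun i hi => congrArg v (h i hi)) _

/-- Coherence: there is at most one coherence isomorphism inducing a given map on labels. -/
theorem unique {u : Omega → Omega} {e e' : Formal D} {f g : e.eval ⟶ e'.eval}
    (hf : Coh u e e' f) (hg : Coh u e e' g) (h : e'.labels.Nodup) : f = g := by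
  have h' : (e'.labels.map id).Nodup := by simpa using h
  let s : St (𝟙_ D) := ⟨[], 𝟙 _⟩
  have : IsIso s.hom := inferInstanceAs (IsIso (𝟙 (𝟙_ D)))
  have := St.isIso_act id e' s
  have key := (hf.pre_act id h' s).trans (hg.pre_act id h' s).symm
  simp only [St.pre, St.mk.injEq, heq_eq_eq, true_and, cancel_mono] at key
  simpa using key

theorem refl (e : Formal D) : Coh id e e (𝟙 _) := by
  simpa using (left_unitor_inv e).comp (left_unitor e)

theorem of_eq {e e' : Formal D} (h : e = e') : Coh id e e' (eqToHom (congrArg Formal.eval h)) := by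
  subst h; exact refl e

theorem comp_id {u : Omega → Omega} {a b c : Formal D} {f : a.eval ⟶ b.eval}
    {g : b.eval ⟶ c.eval} (hf : Coh u a b f) (hg : Coh id b c g) : Coh u a c (f ≫ g) :=
  hf.comp hg

theorem id_comp {u : Omega → Omega} {a b c : Formal D} {f : a.eval ⟶ b.eval}
    {g : b.eval ⟶ c.eval} (hf : Coh id a b f) (hg : Coh u b c g) : Coh u a c (f ≫ g) :=
  hf.comp hg

/-- Coherence isomorphisms whose inverse is a coherence isomorphism exist between `e` and `e'`. -/
def Linked (e e' : Formal D) : Prop :=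
  ∃ f : e.eval ≅ e'.eval, Coh id e e' f.hom ∧ Coh id e' e f.inv

theorem Linked.trans {a b c : Formal D} (h : Linked a b) (h' : Linked b c) : Linked a c := by
  obtain ⟨f, hf, hf'⟩ := h
  obtain ⟨g, hg, hg'⟩ := h'
  exact ⟨f ≪≫ g, hf.comp_id hg, hg'.comp_id hf'⟩

theorem Linked.symm {a b : Formal D} (h : Linked a b) : Linked b a := by
  obtain ⟨f, hf, hf'⟩ := h
  exact ⟨f.symm, hf', hf⟩

theorem Linked.tensor {a a' b b' : Formal D} (h : Linked a a') (h' : Linked b b') :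
    Linked (a.tensor b) (a'.tensor b') := by
  obtain ⟨f, hf, hf'⟩ := h
  obtain ⟨g, hg, hg'⟩ := h'
  exact ⟨f ⊗ᵢ g, .tensor hf hg, .tensor hf' hg'⟩

theorem Linked.refl (a : Formal D) : Linked a a := ⟨Iso.refl _, .refl a, .refl a⟩

theorem linked_append (l l' : List (Omega × D)) :
    Linked ((Formal.ofList l).tensor (Formal.ofList l')) (Formal.ofList (l ++ l')) := by
  induction l with
  | nil => exact ⟨λ_ _, .left_unitor _, .left_unitor_inv _⟩
  | cons p l ih =>
    exact Linked.trans
      (b := (Formal.leaf p.1 p.2).tensor ((Formal.ofList l).tensor (Formal.ofList l')))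
      ⟨α_ _ _ _, .assoc (.leaf p.1 p.2) (.ofList l) (.ofList l'),
        .assoc_inv (.leaf p.1 p.2) (.ofList l) (.ofList l')⟩
      (Linked.tensor (.refl (.leaf p.1 p.2)) ih)

theorem linked_ofList (e : Formal D) : Linked e (Formal.ofList e.leaves) := by
  induction e with
  | unit => exact .refl _
  | leaf i x => exact ⟨(ρ_ _).symm, .right_unitor_inv (.leaf i x), .right_unitor (.leaf i x)⟩
  | tensor a b iha ihb => exact (Linked.tensor iha ihb).trans (linked_append _ _)

theorem linked_of_perm {l l' : List (Omega × D)} (h : l.Perm l') :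
    Linked (Formal.ofList l) (Formal.ofList l') := by
  induction h with
  | nil => exact .refl _
  | cons p _ ih => exact Linked.tensor (.refl (.leaf p.1 p.2)) ih
  | swap p q l =>
    have h1 (p q : Omega × D) : Linked (Formal.ofList (p :: q :: l))
        (((Formal.leaf p.1 p.2).tensor (.leaf q.1 q.2)).tensor (.ofList l)) :=
      ⟨(α_ _ _ _).symm, .assoc_inv (.leaf p.1 p.2) (.leaf q.1 q.2) (.ofList l),
        .assoc (.leaf p.1 p.2) (.leaf q.1 q.2) (.ofList l)⟩
    have h2 : Linked ((Formal.leaf q.1 q.2).tensor (.leaf p.1 p.2))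
        ((Formal.leaf p.1 p.2).tensor (.leaf q.1 q.2)) := by
      refine ⟨β_ _ _, .braiding (.leaf q.1 q.2) (.leaf p.1 p.2), ?_⟩
      have := Coh.braiding (Formal.leaf p.1 p.2) (Formal.leaf q.1 q.2)
      rwa [SymmetricCategory.braiding_swap_eq_inv_braiding] at this
    exact (h1 q p).trans ((Linked.tensor h2 (.refl _)).trans (h1 p q).symm)
  | trans _ _ ih ih' => exact ih.trans ih'

theorem exists_map (u : Omega → Omega) (l : List (Omega × D)) :
    ∃ f : (Formal.ofList l).eval ≅ (Formal.ofList (l.map (Prod.map u id))).eval,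
      Coh u (.ofList l) (.ofList (l.map (Prod.map u id))) f.hom := by
  induction l with
  | nil => exact ⟨Iso.refl _, .unit u⟩
  | cons p l ih =>
    obtain ⟨f, hf⟩ := ih
    exact ⟨Iso.refl p.2 ⊗ᵢ f, .tensor (.leaf u p.1 p.2) hf⟩

theorem exists_iso {u : Omega → Omega} {e e' : Formal D}
    (h : e'.leaves.Perm (e.leaves.map (Prod.map u id))) :
    ∃ f : e.eval ≅ e'.eval, Coh u e e' f.hom := by
  obtain ⟨f, hf, -⟩ := linked_ofList e
  obtain ⟨g, hg⟩ := exists_map u e.leaves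
  obtain ⟨k, hk, -⟩ := linked_of_perm h.symm
  obtain ⟨m, hm, -⟩ := (linked_ofList e').symm
  exact ⟨f ≪≫ g ≪≫ k ≪≫ m, hf.id_comp (hg.comp_id (hk.comp_id hm))⟩

end Coh

/-- The coherence isomorphism between two formal tensor products that moves the factor with label
`i` to the factor with label `u i`. If the labels of `e'` are distinct, then it is the only one. -/
noncomputable def cohIso {u : Omega → Omega} {e e' : Formal D}
    (h : e'.leaves.Perm (e.leaves.map (Prod.map u id))) : e.eval ≅ e'.eval :=
  (Coh.exists_iso h).choose

theorem coh_cohIso {u : Omega → Omega} {e e' : Formal D}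
    (h : e'.leaves.Perm (e.leaves.map (Prod.map u id))) : Coh u e e' (cohIso h).hom :=
  (Coh.exists_iso h).choose_spec

end Coherence

/-! ### Parsummable categories -/

section Parsummable

/-- The monoid `M` of injective self-maps of `ω`, as a submonoid of all self-maps. -/
def injections : Submonoid (Function.End Omega) where
  carrier := {f | Function.Injective f}
  mul_mem' hf hg := Function.Injective.comp hf hg
  one_mem' := Function.injective_id

/-- The monoid of injective self-maps of `ω`. It acts on `ω` by evaluation. -/
abbrev M : Type := injections

theorem M.injective (u : M) : Function.Injective (fun i : Omega => u • i) := u.2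

/-- A category with a strict action of the strict monoidal category `EM`. Such an action amounts
to an action of `M` on objects together with isomorphisms `u_∘ : X ≅ u_* X` that satisfy
`(uv)_∘ = u_∘ v_∘`; the remaining data are `u_* f = u_∘ f u_∘⁻¹` and `[v, u] = v_∘ u_∘⁻¹`. -/
class EMCat (C : Type u) [Category.{v} C] extends MulAction M C where
  circ (u : M) (X : C) : X ≅ u • X
  circ_mul (u v : M) (X : C) : (circ (u * v) X).hom =
    (circ v X).hom ≫ (circ u (v • X)).hom ≫ eqToHom (mul_smul u v X).symm

namespace EMCat

variable {C : Type u} [Category.{v} C] [EMCat C]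

/-- The action of `u : M` on morphisms. -/
def map (u : M) {X Y : C} (f : X ⟶ Y) : u • X ⟶ u • Y :=
  (circ u X).inv ≫ f ≫ (circ u Y).hom

/-- `X` is supported on the finite set `A`. -/
def IsSupportedOn (X : C) (A : Finset Omega) : Prop :=
  ∀ u : M, (∀ a ∈ A, u • a = a) → u • X = X

/-- The support: the intersection of all finite sets on which `X` is supported. -/
def supp (X : C) : Set Omega := {i | ∀ A : Finset Omega, IsSupportedOn X A → i ∈ A}

theorem exists_perm (u : M) (A : Finset Omega) : ∃ w : Mˣ, ∀ a ∈ A, (w : M) • a = u • a := by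
  classical
  let F : Finset Omega := A ∪ A.image (fun i => u • i)
  let e : {x : F // (x : Omega) ∈ A} ≃ {x : F // (x : Omega) ∈ A.image (fun i => u • i)} :=
    Equiv.ofBijective (fun x => ⟨⟨u • (x : Omega), Finset.mem_union_right _
        (Finset.mem_image_of_mem _ x.2)⟩, Finset.mem_image_of_mem _ x.2⟩) (by
      constructor
      · intro x y h
        have : u • ((x : F) : Omega) = u • ((y : F) : Omega) :=
          congrArg (fun z => ((z.1 : F) : Omega)) h
        exact Subtype.ext (Subtype.ext (u.injective this))
      · rintro ⟨⟨y, hy⟩, hy'⟩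
        obtain ⟨a, ha, rfl⟩ := Finset.mem_image.mp hy'
        exact ⟨⟨⟨a, Finset.mem_union_left _ ha⟩, ha⟩, rfl⟩)
  let p : Equiv.Perm Omega := Equiv.Perm.ofSubtype e.extendSubtype
  refine ⟨⟨⟨(p : Omega → Omega), p.injective⟩, ⟨(p.symm : Omega → Omega), p.symm.injective⟩, ?_, ?_⟩,
    ?_⟩
  · exact Subtype.ext (funext fun i => p.apply_symm_apply i)
  · exact Subtype.ext (funext fun i => p.symm_apply_apply i)
  · intro a ha
    have haF : a ∈ F := Finset.mem_union_left _ ha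
    change p a = u • a
    rw [Equiv.Perm.ofSubtype_apply_of_mem _ haF, Equiv.extendSubtype_apply_of_mem e ⟨a, haF⟩ ha]
    rfl

theorem IsSupportedOn.smul_congr {X : C} {A : Finset Omega} (h : IsSupportedOn X A) {u v : M}
    (huv : ∀ a ∈ A, u • a = v • a) : u • X = v • X := by
  obtain ⟨w, hw⟩ := exists_perm u A
  have key (t : M) (ht : ∀ a ∈ A, u • a = t • a) : t • X = (w : M) • X := by
    have := h ((w⁻¹ : Mˣ) * t) (fun a ha => by
      rw [mul_smul, ← ht a ha, ← hw a ha, ← mul_smul, Units.inv_mul, one_smul])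
    calc t • X = ((w : M) * ((w⁻¹ : Mˣ) * t)) • X := by rw [← mul_assoc, Units.mul_inv, one_mul]
      _ = (w : M) • X := by rw [mul_smul, this]
  rw [key u (fun _ _ => rfl), key v huv]

theorem IsSupportedOn.smul {X : C} {A : Finset Omega} (h : IsSupportedOn X A) (u : M) :
    IsSupportedOn (u • X) (A.image (fun i => u • i)) := by
  intro w hw
  rw [← mul_smul]
  refine h.smul_congr (fun a ha => ?_)
  rw [mul_smul, hw _ (Finset.mem_image_of_mem _ ha)]

theorem supp_subset {X : C} {A : Finset Omega} (h : IsSupportedOn X A) : supp X ⊆ A :=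
  fun _ hi => hi A h

theorem supp_smul_subset {X : C} {A : Finset Omega} (h : IsSupportedOn X A) (u : M) :
    supp (u • X) ⊆ (fun i => u • i) '' supp X := by
  classical
  intro i hi
  have h1 (B : Finset Omega) (hB : IsSupportedOn X B) : ∃ b ∈ B, u • b = i :=
    Finset.mem_image.mp (hi _ (hB.smul u))
  obtain ⟨a, -, rfl⟩ := h1 A h
  refine ⟨a, fun B hB => ?_, rfl⟩
  obtain ⟨b, hb, hab⟩ := h1 B hB
  rwa [← u.injective hab]

end EMCat

open EMCat

/-- A parsummable category: a tame `EM`-category with a zero object and a sum operation, defined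
for disjointly supported objects and for morphisms between such, that is strictly unital,
commutative and associative, functorial, and `EM`-equivariant. -/
class Parsummable (C : Type u) [Category.{v} C] extends EMCat C where
  tame (X : C) : ∃ A : Finset Omega, IsSupportedOn X A
  zero : C
  smul_zero (u : M) : u • zero = zero
  add (X Y : C) (h : Disjoint (supp X) (supp Y)) : C
  add_zero (X : C) (h : Disjoint (supp X) (supp zero)) : add X zero h = X
  add_comm (X Y : C) (h : Disjoint (supp X) (supp Y)) : add X Y h = add Y X h.symm
  add_assoc (X Y Z : C) (hXY : Disjoint (supp X) (supp Y)) (hYZ : Disjoint (supp Y) (supp Z))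
    (hXZ : Disjoint (supp X) (supp Z)) (h₁ : Disjoint (supp (add X Y hXY)) (supp Z))
    (h₂ : Disjoint (supp X) (supp (add Y Z hYZ))) :
    add (add X Y hXY) Z h₁ = add X (add Y Z hYZ) h₂
  smul_add (u : M) (X Y : C) (h : Disjoint (supp X) (supp Y))
    (h' : Disjoint (supp (u • X)) (supp (u • Y))) : u • add X Y h = add (u • X) (u • Y) h'
  addHom {X X' Y Y' : C} (f : X ⟶ X') (g : Y ⟶ Y') (h : Disjoint (supp X) (supp Y))
    (h' : Disjoint (supp X') (supp Y')) : add X Y h ⟶ add X' Y' h'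
  addHom_id (X Y : C) (h : Disjoint (supp X) (supp Y)) : addHom (𝟙 X) (𝟙 Y) h h = 𝟙 _
  addHom_comp {X X' X'' Y Y' Y'' : C} (f : X ⟶ X') (f' : X' ⟶ X'') (g : Y ⟶ Y') (g' : Y' ⟶ Y'')
    (h : Disjoint (supp X) (supp Y)) (h' : Disjoint (supp X') (supp Y'))
    (h'' : Disjoint (supp X'') (supp Y'')) :
    addHom f g h h' ≫ addHom f' g' h' h'' = addHom (f ≫ f') (g ≫ g') h h''
  addHom_zero {X X' : C} (f : X ⟶ X') (h : Disjoint (supp X) (supp zero))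
    (h' : Disjoint (supp X') (supp zero)) :
    addHom f (𝟙 zero) h h' = eqToHom (add_zero X h) ≫ f ≫ eqToHom (add_zero X' h').symm
  addHom_comm {X X' Y Y' : C} (f : X ⟶ X') (g : Y ⟶ Y') (h : Disjoint (supp X) (supp Y))
    (h' : Disjoint (supp X') (supp Y')) :
    addHom f g h h' =
      eqToHom (add_comm X Y h) ≫ addHom g f h.symm h'.symm ≫ eqToHom (add_comm X' Y' h').symm
  addHom_assoc {X X' Y Y' Z Z' : C} (f : X ⟶ X') (g : Y ⟶ Y') (k : Z ⟶ Z')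
    (hXY : Disjoint (supp X) (supp Y)) (hYZ : Disjoint (supp Y) (supp Z))
    (hXZ : Disjoint (supp X) (supp Z)) (h₁ : Disjoint (supp (add X Y hXY)) (supp Z))
    (h₂ : Disjoint (supp X) (supp (add Y Z hYZ)))
    (hXY' : Disjoint (supp X') (supp Y')) (hYZ' : Disjoint (supp Y') (supp Z'))
    (hXZ' : Disjoint (supp X') (supp Z')) (h₁' : Disjoint (supp (add X' Y' hXY')) (supp Z'))
    (h₂' : Disjoint (supp X') (supp (add Y' Z' hYZ'))) :
    addHom (addHom f g hXY hXY') k h₁ h₁' =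
      eqToHom (add_assoc X Y Z hXY hYZ hXZ h₁ h₂) ≫
        addHom f (addHom g k hYZ hYZ') h₂ h₂' ≫
          eqToHom (add_assoc X' Y' Z' hXY' hYZ' hXZ' h₁' h₂').symm
  circ_add (u : M) (X Y : C) (h : Disjoint (supp X) (supp Y))
    (h' : Disjoint (supp (u • X)) (supp (u • Y))) :
    (circ u (add X Y h)).hom ≫ eqToHom (smul_add u X Y h h') =
      addHom (circ u X).hom (circ u Y).hom h h'

namespace Parsummable

variable {C : Type u} [Category.{v} C] [Parsummable C]

theorem finite_supp (X : C) : (supp X).Finite := by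
  obtain ⟨A, hA⟩ := tame X
  exact A.finite_toSet.subset (supp_subset hA)

theorem disjoint_smul {X Y : C} (h : Disjoint (supp X) (supp Y)) (u : M) :
    Disjoint (supp (u • X)) (supp (u • Y)) := by
  obtain ⟨A, hA⟩ := tame X
  obtain ⟨B, hB⟩ := tame Y
  exact (Set.disjoint_image_of_injective u.injective h).mono (supp_smul_subset hA u)
    (supp_smul_subset hB u)

theorem supp_zero : supp (zero : C) = ∅ := by
  have : IsSupportedOn (zero : C) ∅ := fun u _ => smul_zero u
  simpa using supp_subset this

theorem supp_add_subset (X Y : C) (h : Disjoint (supp X) (supp Y)) :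
    supp (add X Y h) ⊆ supp X ∪ supp Y := by
  classical
  intro i hi
  by_contra hn
  simp only [Set.mem_union, not_or, supp, Set.mem_ofPred_eq, not_forall] at hn
  obtain ⟨⟨A, hA, hiA⟩, ⟨B, hB, hiB⟩⟩ := hn
  have hAB : IsSupportedOn (add X Y h) (A ∪ B) := by
    intro u hu
    rw [smul_add u X Y h (disjoint_smul h u)]
    have e1 := hA u (fun a ha => hu a (Finset.mem_union_left _ ha))
    have e2 := hB u (fun a ha => hu a (Finset.mem_union_right _ ha))
    congr 1
  rcases Finset.mem_union.mp (hi _ hAB) with h | h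
  · exact hiA h
  · exact hiB h

theorem addHom_eqToHom {X X' Y Y' : C} (hX : X = X') (hY : Y = Y')
    (h : Disjoint (supp X) (supp Y)) (h' : Disjoint (supp X') (supp Y')) :
    addHom (eqToHom hX) (eqToHom hY) h h' = eqToHom (by subst hX hY; rfl) := by
  subst hX hY
  exact addHom_id _ _ _

end Parsummable

open Parsummable

/-! ### Path components and their monoid structure -/

/-- The part of a partially defined sum operation that is needed to add path components. -/
structure SumData (E : Type u) [Category.{v} E] where
  sp : E → Set Omega
  finite_sp (X : E) : (sp X).Finite
  zero : E
  sp_zero : sp zero = ∅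
  add (X Y : E) (h : Disjoint (sp X) (sp Y)) : E
  sp_add (X Y : E) (h : Disjoint (sp X) (sp Y)) : sp (add X Y h) ⊆ sp X ∪ sp Y
  add_zero (X : E) (h : Disjoint (sp X) (sp zero)) : add X zero h = X
  add_comm (X Y : E) (h : Disjoint (sp X) (sp Y)) : add X Y h = add Y X h.symm
  add_assoc (X Y Z : E) (hXY : Disjoint (sp X) (sp Y)) (hYZ : Disjoint (sp Y) (sp Z))
    (hXZ : Disjoint (sp X) (sp Z)) (h₁ : Disjoint (sp (add X Y hXY)) (sp Z))
    (h₂ : Disjoint (sp X) (sp (add Y Z hYZ))) :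
    add (add X Y hXY) Z h₁ = add X (add Y Z hYZ) h₂
  add_hom {X X' Y Y' : E} (f : X ⟶ X') (g : Y ⟶ Y') (h : Disjoint (sp X) (sp Y))
    (h' : Disjoint (sp X') (sp Y')) : Nonempty (add X Y h ⟶ add X' Y' h')
  move (Y : E) (A : Set Omega) (hA : A.Finite) :
    ∃ Y' : E, Nonempty (Y ≅ Y') ∧ Disjoint A (sp Y')

namespace SumData

variable {E : Type u} [Category.{v} E] (S : SumData E)

theorem zigzag_right {X Y Y' : E} (h : Disjoint (S.sp X) (S.sp Y)) (z : Zigzag Y Y') :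
    ∀ (Y₁ : E) (_ : Y₁ ≅ Y') (h₁ : Disjoint (S.sp X) (S.sp Y₁)),
      Zigzag (S.add X Y h) (S.add X Y₁ h₁) := by
  induction z with
  | refl => exact fun Y₁ e h₁ => Zigzag.of_inv (S.add_hom (𝟙 X) e.hom h₁ h).some
  | @tail Y' Y'' _ z ih =>
    intro Y₁ e h₁
    obtain ⟨Y₂, ⟨e₂⟩, h₂⟩ := S.move Y' (S.sp X) (S.finite_sp X)
    refine (ih Y₂ e₂.symm h₂).trans ?_
    rcases z with ⟨⟨f⟩⟩ | ⟨⟨f⟩⟩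
    · exact Zigzag.of_hom (S.add_hom (𝟙 X) (e₂.inv ≫ f ≫ e.inv) h₂ h₁).some
    · exact Zigzag.of_inv (S.add_hom (𝟙 X) (e.hom ≫ f ≫ e₂.hom) h₁ h₂).some

theorem zigzag_add {X X' Y Y' : E} (zX : Zigzag X X') (zY : Zigzag Y Y')
    (h : Disjoint (S.sp X) (S.sp Y)) (h' : Disjoint (S.sp X') (S.sp Y')) :
    Zigzag (S.add X Y h) (S.add X' Y' h') := by
  obtain ⟨Y₂, ⟨e⟩, h₂⟩ :=
    S.move Y (S.sp X ∪ S.sp X') ((S.finite_sp X).union (S.finite_sp X'))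
  rw [Set.disjoint_union_left] at h₂
  have z₁ : Zigzag (S.add X Y h) (S.add X Y₂ h₂.1) :=
    S.zigzag_right h (Zigzag.of_hom e.hom) Y₂ (Iso.refl _) h₂.1
  have z₂ : Zigzag (S.add X Y₂ h₂.1) (S.add X' Y₂ h₂.2) := by
    rw [S.add_comm X, S.add_comm X']
    exact S.zigzag_right h₂.1.symm zX X' (Iso.refl _) h₂.2.symm
  have z₃ : Zigzag (S.add X' Y₂ h₂.2) (S.add X' Y' h') :=
    S.zigzag_right h₂.2 ((Zigzag.of_inv e.hom).trans zY) Y' (Iso.refl _) h'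
  exact z₁.trans (z₂.trans z₃)

/-- The class of an object in the set of path components. -/
def cls {E : Type u} [Category.{v} E] (X : E) : ConnectedComponents E := Quotient.mk'' X

theorem cls_eq {X Y : E} : cls X = cls Y ↔ Zigzag X Y := Quotient.eq''

/-- Addition of path components, via disjointly supported representatives. -/
noncomputable def plus : ConnectedComponents E → ConnectedComponents E → ConnectedComponents E :=
  Quotient.map₂ (fun X Y => S.add X (S.move Y (S.sp X) (S.finite_sp X)).choose
      (S.move Y (S.sp X) (S.finite_sp X)).choose_spec.2) (by
    intro X X' zX Y Y' zY
    refine S.zigzag_add zX ?_ _ _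
    exact (Zigzag.of_inv (S.move Y _ (S.finite_sp X)).choose_spec.1.some.hom).trans
      (Zigzag.trans zY (Zigzag.of_hom (S.move Y' _ (S.finite_sp X')).choose_spec.1.some.hom)))

theorem plus_cls (X Y : E) (h : Disjoint (S.sp X) (S.sp Y)) :
    S.plus (cls X) (cls Y) = cls (S.add X Y h) :=
  cls_eq.mpr (S.zigzag_add (Zigzag.refl X)
    (Zigzag.of_inv (S.move Y _ (S.finite_sp X)).choose_spec.1.some.hom) _ h)

theorem exists_rep (x : ConnectedComponents E) (A : Set Omega) (hA : A.Finite) :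
    ∃ X : E, cls X = x ∧ Disjoint A (S.sp X) := by
  obtain ⟨Y, rfl⟩ := Quotient.exists_rep x
  obtain ⟨X, ⟨e⟩, h⟩ := S.move Y A hA
  exact ⟨X, cls_eq.mpr (Zigzag.of_inv e.hom), h⟩

/-- The commutative monoid of path components: `[X] + [Y] = [X + Y]` whenever `X + Y` is defined. -/
noncomputable abbrev monoid : AddCommMonoid (ConnectedComponents E) where
  add := S.plus
  zero := cls S.zero
  nsmul := @nsmulRec _ ⟨cls S.zero⟩ ⟨S.plus⟩
  add_zero x := by
    obtain ⟨X, rfl⟩ := Quotient.exists_rep x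
    have h : Disjoint (S.sp X) (S.sp S.zero) := by rw [S.sp_zero]; exact Set.disjoint_empty _
    exact (S.plus_cls X S.zero h).trans (by rw [S.add_zero]; rfl)
  zero_add x := by
    obtain ⟨X, rfl⟩ := Quotient.exists_rep x
    have h : Disjoint (S.sp S.zero) (S.sp X) := by rw [S.sp_zero]; exact Set.empty_disjoint _
    exact (S.plus_cls S.zero X h).trans (by rw [S.add_comm, S.add_zero]; rfl)
  add_comm x y := by
    obtain ⟨X, rfl, -⟩ := S.exists_rep x ∅ Set.finite_empty
    obtain ⟨Y, rfl, h⟩ := S.exists_rep y _ (S.finite_sp X)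
    exact (S.plus_cls X Y h).trans ((congrArg cls (S.add_comm X Y h)).trans
      (S.plus_cls Y X h.symm).symm)
  add_assoc x y z := by
    obtain ⟨X, rfl, -⟩ := S.exists_rep x ∅ Set.finite_empty
    obtain ⟨Y, rfl, hXY⟩ := S.exists_rep y _ (S.finite_sp X)
    obtain ⟨Z, rfl, hZ⟩ := S.exists_rep z _ ((S.finite_sp X).union (S.finite_sp Y))
    have h₁ := hZ.mono_left (S.sp_add X Y hXY)
    rw [Set.disjoint_union_left] at hZ
    have h₂ : Disjoint (S.sp X) (S.sp (S.add Y Z hZ.2)) :=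
      Disjoint.mono_right (S.sp_add Y Z hZ.2) (Set.disjoint_union_right.mpr ⟨hXY, hZ.1⟩)
    change S.plus (S.plus _ _) _ = S.plus _ (S.plus _ _)
    rw [S.plus_cls X Y hXY, S.plus_cls Y Z hZ.2, S.plus_cls _ _ h₁, S.plus_cls _ _ h₂,
      S.add_assoc X Y Z hXY hZ.2 hZ.1 h₁ h₂]

end SumData

/-- The sum operation of a parsummable category. -/
def sumData (C : Type u) [Category.{v} C] [Parsummable C] : SumData C where
  sp := supp
  finite_sp := finite_supp
  zero := Parsummable.zero
  sp_zero := supp_zero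
  add := Parsummable.add
  sp_add := supp_add_subset
  add_zero := Parsummable.add_zero
  add_comm := Parsummable.add_comm
  add_assoc := Parsummable.add_assoc
  add_hom f g h h' := ⟨addHom f g h h'⟩
  move Y A hA := by
    obtain ⟨N, hN⟩ := hA.bddAbove
    let w : M := ⟨fun i => i + N, fun i j h => add_right_cancel h⟩
    refine ⟨w • Y, ⟨circ w Y⟩, ?_⟩
    obtain ⟨B, hB⟩ := tame Y
    refine Disjoint.mono_right (supp_smul_subset hB w) ?_
    rw [Set.disjoint_left]
    rintro _ hi ⟨j, -, rfl⟩
    exact absurd (hN hi) (not_le.mpr (PNat.lt_add_left N j))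

/-- A universal subgroup of `M`: a finite subgroup `G` (necessarily contained in the units of `M`)
such that every finite `G`-set embeds equivariantly into `ω`. -/
structure UniversalSubgroup where
  group : Subgroup Mˣ
  finite : Finite group
  universal (A : Type) [Finite A] [MulAction group A] :
    ∃ f : A → Omega, Function.Injective f ∧ ∀ (g : group) (a : A), f (g • a) = g • f a

/-- There is an equivariant injection that moves one finite set away from another. -/
theorem UniversalSubgroup.exists_move (G : UniversalSubgroup) (A B : Set Omega) (hA : A.Finite)
    (hB : B.Finite) :
    ∃ w : M, (∀ g ∈ G.group, (g : M) * w = w * g) ∧ ∀ b ∈ B, w • b ∉ A := by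
  classical
  have := G.finite
  let T : Set Omega := (fun p : G.group × Omega => p.1 • p.2) '' (Set.univ ×ˢ (A ∪ B))
  have hT : T.Finite := (Set.finite_univ.prod (hA.union hB)).image _
  have hTs (g : G.group) {i : Omega} (hi : i ∈ T) : g • i ∈ T := by
    obtain ⟨⟨k, a⟩, ⟨-, ha⟩, rfl⟩ := hi
    exact ⟨(g * k, a), ⟨trivial, ha⟩, mul_smul g k a⟩
  have hAB : A ∪ B ⊆ T := fun i hi => ⟨(1, i), ⟨trivial, hi⟩, one_smul _ i⟩
  have : Finite T := hT
  let n := Nat.card T + 1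
  let _ : MulAction G.group (T × Fin n) :=
    { smul := fun g p => (⟨g • (p.1 : Omega), hTs g p.1.2⟩, p.2)
      one_smul := fun p => Prod.ext (Subtype.ext (one_smul G.group (p.1 : Omega))) rfl
      mul_smul := fun g k p => Prod.ext (Subtype.ext (mul_smul g k (p.1 : Omega))) rfl }
  obtain ⟨f, hf, hfg⟩ := G.universal (T × Fin n)
  have hk : ∃ k : Fin n, ∀ t : T, f (t, k) ∉ T := by
    by_contra hcon
    push Not at hcon
    choose t ht using hcon
    have hinj : Function.Injective (fun k : Fin n => (⟨f (t k, k), ht k⟩ : T)) := by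
      intro k l hkl
      exact (Prod.ext_iff.mp (hf (Subtype.ext_iff.mp hkl))).2
    have := Nat.card_le_card_of_injective _ hinj
    simp [n] at this
  obtain ⟨k, hk⟩ := hk
  let w : Omega → Omega := fun i =>
    if h : i ∈ T then f (⟨i, h⟩, k) else if h' : ∃ t : T, f (t, k) = i then h'.choose else i
  have w1 (t : T) : w t = f (t, k) := dif_pos t.2
  have w2 (t : T) : w (f (t, k)) = t := by
    have h' : ∃ t' : T, f (t', k) = f (t, k) := ⟨t, rfl⟩
    have e : w (f (t, k)) = h'.choose := (dif_neg (hk t)).trans (dif_pos h')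
    rw [e]
    exact congrArg Subtype.val (Prod.ext_iff.mp (hf h'.choose_spec)).1
  have w3 (i : Omega) (h : i ∉ T) (h' : ¬ ∃ t : T, f (t, k) = i) : w i = i :=
    (dif_neg h).trans (dif_neg h')
  have hww (i : Omega) : w (w i) = i := by
    by_cases h : i ∈ T
    · have := w1 ⟨i, h⟩
      rw [show w i = f (⟨i, h⟩, k) from this, w2]
    · by_cases h' : ∃ t : T, f (t, k) = i
      · obtain ⟨t, rfl⟩ := h'
        rw [w2, w1]
      · rw [w3 i h h', w3 i h h']
  have hgw (g : G.group) (i : Omega) : g • w i = w (g • i) := by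
    have hf' (t : T) : f (⟨g • (t : Omega), hTs g t.2⟩, k) = g • f (t, k) := hfg g (t, k)
    by_cases h : i ∈ T
    · have e1 := w1 ⟨i, h⟩
      have e2 := w1 ⟨g • i, hTs g h⟩
      simp only at e1 e2
      rw [e1, e2, hf' ⟨i, h⟩]
    · by_cases h' : ∃ t : T, f (t, k) = i
      · obtain ⟨t, rfl⟩ := h'
        rw [w2, ← hf', w2]
      · rw [w3 i h h', w3]
        · intro hc
          exact h (by simpa using hTs g⁻¹ hc)
        · rintro ⟨t, ht⟩
          refine h' ⟨⟨g⁻¹ • (t : Omega), hTs g⁻¹ t.2⟩, ?_⟩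
          rw [show f (⟨g⁻¹ • (t : Omega), hTs g⁻¹ t.2⟩, k) = g⁻¹ • f (t, k) from hfg g⁻¹ (t, k), ht]
          simp
  refine ⟨⟨w, Function.LeftInverse.injective hww⟩, fun g hg => ?_, fun b hb hc => ?_⟩
  · exact Subtype.ext (funext fun i => hgw ⟨g, hg⟩ i)
  · have e := w1 ⟨b, hAB (Or.inr hb)⟩
    have hc' : w b ∈ A := hc
    simp only at e
    rw [e] at hc'
    exact hk _ (hAB (Or.inl hc'))

/-- An object of the category `C^G` of `G`-fixed points. -/
structure Fixed (G : Subgroup Mˣ) (C : Type u) [Category.{v} C] [EMCat C] where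
  obj : C
  smul_eq (g : Mˣ) (hg : g ∈ G) : (g : M) • obj = obj

namespace Fixed

section

variable {G : Subgroup Mˣ} {C : Type u} [Category.{v} C] [EMCat C]

/-- A morphism `f` between `G`-fixed objects is fixed if `g_* f = f` for all `g ∈ G`. -/
def IsFixedHom {X Y : Fixed G C} (f : X.obj ⟶ Y.obj) : Prop :=
  ∀ (g : Mˣ) (hg : g ∈ G),
    EMCat.map (g : M) f = eqToHom (X.smul_eq g hg) ≫ f ≫ eqToHom (Y.smul_eq g hg).symm

theorem isFixedHom_iff {X Y : Fixed G C} (f : X.obj ⟶ Y.obj) : IsFixedHom f ↔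
    ∀ (g : Mˣ) (hg : g ∈ G), f ≫ (circ (g : M) Y.obj).hom ≫ eqToHom (Y.smul_eq g hg) =
      (circ (g : M) X.obj).hom ≫ eqToHom (X.smul_eq g hg) ≫ f := by
  refine forall₂_congr fun g hg => ?_
  rw [EMCat.map, Iso.inv_comp_eq, ← cancel_mono (eqToHom (Y.smul_eq g hg))]
  simp

instance : Category.{v} (Fixed G C) where
  Hom X Y := {f : X.obj ⟶ Y.obj // IsFixedHom f}
  id X := ⟨𝟙 _, by rw [isFixedHom_iff]; simp⟩
  comp f g := ⟨f.1 ≫ g.1, by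
    obtain ⟨f, hf⟩ := f
    obtain ⟨g, hg⟩ := g
    rw [isFixedHom_iff] at hf hg ⊢
    intro k hk
    simp only [Category.assoc]
    rw [hg k hk, reassoc_of% (hf k hk)]⟩

theorem comp_val {X Y Z : Fixed G C} (f : X ⟶ Y) (g : Y ⟶ Z) : (f ≫ g).1 = f.1 ≫ g.1 := rfl

theorem id_val (X : Fixed G C) : Subtype.val (𝟙 X) = 𝟙 X.obj := rfl

/-- An isomorphism of underlying objects that is fixed. -/
def mkIso {X Y : Fixed G C} (f : X.obj ≅ Y.obj) (hf : IsFixedHom f.hom) : X ≅ Y where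
  hom := ⟨f.hom, hf⟩
  inv := ⟨f.inv, by
    rw [isFixedHom_iff] at hf ⊢
    intro g hg
    rw [Iso.inv_comp_eq, ← Category.assoc, ← Category.assoc, Iso.eq_comp_inv, Category.assoc,
      Category.assoc]
    exact (hf g hg).symm⟩
  hom_inv_id := Subtype.ext f.hom_inv_id
  inv_hom_id := Subtype.ext f.inv_hom_id

end

section

variable {C : Type u} [Category.{v} C] [Parsummable C]

/-- The sum of fixed objects. -/
@[reducible]
def add {G : Subgroup Mˣ} (X Y : Fixed G C) (h : Disjoint (supp X.obj) (supp Y.obj)) :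
    Fixed G C where
  obj := Parsummable.add X.obj Y.obj h
  smul_eq g hg := by
    rw [Parsummable.smul_add _ _ _ h (disjoint_smul h _)]
    have e1 := X.smul_eq g hg
    have e2 := Y.smul_eq g hg
    congr 1

theorem isFixedHom_addHom {G : Subgroup Mˣ} {X X' Y Y' : Fixed G C} (f : X ⟶ X') (g : Y ⟶ Y')
    (h : Disjoint (supp X.obj) (supp Y.obj)) (h' : Disjoint (supp X'.obj) (supp Y'.obj)) :
    IsFixedHom (X := add X Y h) (Y := add X' Y' h') (addHom f.1 g.1 h h') := by
  refine (isFixedHom_iff (X := add X Y h) (Y := add X' Y' h') _).mpr ?_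
  intro k hk
  have key (X Y : Fixed G C) (h : Disjoint (supp X.obj) (supp Y.obj)) :
      (circ (k : M) (add X Y h).obj).hom ≫ eqToHom ((add X Y h).smul_eq k hk) =
        addHom ((circ (k : M) X.obj).hom ≫ eqToHom (X.smul_eq k hk))
          ((circ (k : M) Y.obj).hom ≫ eqToHom (Y.smul_eq k hk)) h h := by
    rw [← addHom_comp _ _ _ _ h (disjoint_smul h _) h, ← circ_add, addHom_eqToHom]
    simp [add]
  rw [reassoc_of% (key X Y h), key X' Y' h']
  simp only [add]
  rw [addHom_comp, addHom_comp, (isFixedHom_iff _).mp f.2 k hk, (isFixedHom_iff _).mp g.2 k hk,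
    Category.assoc, Category.assoc]

end

/-- The sum operation on fixed points. -/
def sumData (C : Type u) [Category.{v} C] [Parsummable C] (G : UniversalSubgroup) :
    SumData (Fixed G.group C) where
  sp X := supp X.obj
  finite_sp X := finite_supp X.obj
  zero := ⟨Parsummable.zero, fun g _ => Parsummable.smul_zero _⟩
  sp_zero := supp_zero
  add := add
  sp_add X Y h := supp_add_subset X.obj Y.obj h
  add_zero X h := by
    obtain ⟨X, hX⟩ := X
    simp only [add, Parsummable.add_zero]
  add_comm X Y h := by
    simp only [add, Parsummable.add_comm X.obj Y.obj h]
  add_assoc X Y Z hXY hYZ hXZ h₁ h₂ := by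
    have := Parsummable.add_assoc X.obj Y.obj Z.obj hXY hYZ hXZ h₁ h₂
    simp only [add, this]
  add_hom f g h h' := ⟨⟨addHom f.1 g.1 h h', isFixedHom_addHom f g h h'⟩⟩
  move Y A hA := by
    obtain ⟨w, hw, hwA⟩ := G.exists_move A (supp Y.obj) hA (finite_supp _)
    refine ⟨⟨w • Y.obj, fun g hg => ?_⟩, ⟨mkIso (circ w Y.obj) ?_⟩, ?_⟩
    · rw [← mul_smul, hw g hg, mul_smul, Y.smul_eq g hg]
    · rw [isFixedHom_iff]
      intro g hg
      have e1 := circ_mul (g : M) w Y.obj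
      have e2 := circ_mul w (g : M) Y.obj
      have e3 (a b : M) (hab : a = b) :
          (circ a Y.obj).hom = (circ b Y.obj).hom ≫ eqToHom (by rw [hab]) := by
        subst hab; simp
      have e4 (P Q : C) (hPQ : P = Q) :
          eqToHom hPQ ≫ (circ w Q).hom = (circ w P).hom ≫ eqToHom (by rw [hPQ]) := by
        subst hPQ; simp
      rw [e3 _ _ (hw g hg), e2] at e1
      rw [e4 _ _ (Y.smul_eq g hg)]
      have e5 : w • Y.obj = ((g : M) * w) • Y.obj := by rw [hw g hg, mul_smul, Y.smul_eq g hg]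
      refine (cancel_mono (eqToHom e5)).mp ?_
      simp only [Category.assoc, eqToHom_trans] at e1 ⊢
      exact e1.symm
    · obtain ⟨B, hB⟩ := tame Y.obj
      refine Disjoint.mono_right (supp_smul_subset hB w) ?_
      rw [Set.disjoint_left]
      rintro _ hi ⟨j, hj, rfl⟩
      exact hwA j hj hi

end Fixed

end Parsummable

/-! ### The category of parsummable categories and its global weak equivalences -/

section ParSumCat

open EMCat Parsummable

/-- A morphism of parsummable categories: a functor that strictly preserves the `EM`-action, the
zero object and the sum. -/
structure IsParsumFunctor {C : Type u} [Category.{v} C] [Parsummable C] {C' : Type u}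
    [Category.{v} C'] [Parsummable C'] (F : C ⥤ C') : Prop where
  map_smul (a : M) (X : C) : F.obj (a • X) = a • F.obj X
  map_circ (a : M) (X : C) :
    F.map (circ a X).hom ≫ eqToHom (map_smul a X) = (circ a (F.obj X)).hom
  map_zero : F.obj zero = zero
  map_add (X Y : C) (h : Disjoint (supp X) (supp Y))
    (h' : Disjoint (supp (F.obj X)) (supp (F.obj Y))) :
    F.obj (add X Y h) = add (F.obj X) (F.obj Y) h'
  map_addHom {X X' Y Y' : C} (f : X ⟶ X') (g : Y ⟶ Y') (h : Disjoint (supp X) (supp Y))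
    (h' : Disjoint (supp X') (supp Y')) (k : Disjoint (supp (F.obj X)) (supp (F.obj Y)))
    (k' : Disjoint (supp (F.obj X')) (supp (F.obj Y'))) :
    F.map (addHom f g h h') =
      eqToHom (map_add X Y h k) ≫ addHom (F.map f) (F.map g) k k' ≫
        eqToHom (map_add X' Y' h' k').symm

namespace IsParsumFunctor

variable {C : Type u} [Category.{v} C] [Parsummable C] {C' : Type u} [Category.{v} C']
  [Parsummable C'] {C'' : Type u} [Category.{v} C''] [Parsummable C'']

theorem supp_subset {F : C ⥤ C'} (hF : IsParsumFunctor F) (X : C) : supp (F.obj X) ⊆ supp X :=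
  fun _ hi A hA => hi A fun a ha => by rw [← hF.map_smul, hA a ha]

theorem disjoint {F : C ⥤ C'} (hF : IsParsumFunctor F) {X Y : C}
    (h : Disjoint (supp X) (supp Y)) : Disjoint (supp (F.obj X)) (supp (F.obj Y)) :=
  h.mono (hF.supp_subset X) (hF.supp_subset Y)

theorem id : IsParsumFunctor (𝟭 C) where
  map_smul _ _ := rfl
  map_circ _ _ := by simp
  map_zero := rfl
  map_add _ _ _ _ := rfl
  map_addHom f g h h' k k' := by simp

theorem comp {F : C ⥤ C'} {F' : C' ⥤ C''} (hF : IsParsumFunctor F) (hF' : IsParsumFunctor F') :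
    IsParsumFunctor (F ⋙ F') where
  map_smul a X := by simp [hF.map_smul, hF'.map_smul]
  map_circ a X := by
    simp [← hF.map_circ, ← hF'.map_circ, eqToHom_map]
  map_zero := by simp [hF.map_zero, hF'.map_zero]
  map_add X Y h h' := by
    simp [hF.map_add X Y h (hF.disjoint h), hF'.map_add _ _ (hF.disjoint h) h']
  map_addHom f g h h' k k' := by
    simp [hF.map_addHom f g h h' (hF.disjoint h) (hF.disjoint h'),
      hF'.map_addHom _ _ (hF.disjoint h) (hF.disjoint h') k k', eqToHom_map]

/-- The functor induced on `G`-fixed points. -/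
def fixed {F : C ⥤ C'} (hF : IsParsumFunctor F) (G : Subgroup Mˣ) : Fixed G C ⥤ Fixed G C' where
  obj X := ⟨F.obj X.obj, fun g hg => by rw [← hF.map_smul, X.smul_eq g hg]⟩
  map {X Y} f := ⟨F.map f.1, by
    rw [Fixed.isFixedHom_iff]
    intro g hg
    have h := congrArg F.map ((Fixed.isFixedHom_iff _).mp f.2 g hg)
    simpa [← hF.map_circ, eqToHom_map] using h⟩
  map_id X := Subtype.ext (F.map_id X.obj)
  map_comp f g := Subtype.ext (F.map_comp f.1 g.1)

end IsParsumFunctor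

/-- Small parsummable categories. -/
structure ParSumCat : Type (u + 1) where
  carrier : Type u
  [category : SmallCategory carrier]
  [parsummable : Parsummable carrier]

attribute [instance] ParSumCat.category ParSumCat.parsummable

namespace ParSumCat

instance : Category.{u} ParSumCat.{u} where
  Hom C C' := {F : C.carrier ⥤ C'.carrier // IsParsumFunctor F}
  id C := ⟨𝟭 C.carrier, IsParsumFunctor.id⟩
  comp F F' := ⟨F.1 ⋙ F'.1, F.2.comp F'.2⟩

/-- The set `π₀ C` of path components of a parsummable category. -/
def Pi0 (C : ParSumCat.{u}) : Type u := ConnectedComponents C.carrier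

/-- The class of an object in `π₀ C`. -/
def Pi0.mk {C : ParSumCat.{u}} (X : C.carrier) : C.Pi0 := Quotient.mk'' X

noncomputable instance (C : ParSumCat.{u}) : AddCommMonoid C.Pi0 := (sumData C.carrier).monoid

/-- The set `π₀ (C^G)` of path components of the category of `G`-fixed points. -/
def FixedPi0 (C : ParSumCat.{u}) (G : UniversalSubgroup) : Type u :=
  ConnectedComponents (Fixed G.group C.carrier)

/-- The class of a fixed object in `π₀ (C^G)`. -/
def FixedPi0.mk {C : ParSumCat.{u}} {G : UniversalSubgroup} (X : Fixed G.group C.carrier) :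
    C.FixedPi0 G := Quotient.mk'' X

noncomputable instance (C : ParSumCat.{u}) (G : UniversalSubgroup) :
    AddCommMonoid (C.FixedPi0 G) := (Fixed.sumData C.carrier G).monoid

/-- The sum on `π₀ C` is induced by the sum of disjointly supported objects. -/
theorem Pi0.mk_add_mk (C : ParSumCat.{u}) (X Y : C.carrier) (h : Disjoint (supp X) (supp Y)) :
    Pi0.mk X + Pi0.mk Y = Pi0.mk (add X Y h) :=
  (sumData C.carrier).plus_cls X Y h

/-- The sum on `π₀ (C^G)` is induced by the sum of disjointly supported objects. -/
theorem FixedPi0.mk_add_mk (C : ParSumCat.{u}) (G : UniversalSubgroup)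
    (X Y : Fixed G.group C.carrier) (h : Disjoint (supp X.obj) (supp Y.obj)) :
    FixedPi0.mk X + FixedPi0.mk Y = FixedPi0.mk (Fixed.add X Y h) :=
  (Fixed.sumData C.carrier G).plus_cls X Y h

end ParSumCat

/-- A functor between small categories is a weak homotopy equivalence if it induces a homotopy
equivalence on classifying spaces. -/
def IsWeakHomotopyEquivalence {A B : Type u} [SmallCategory A] [SmallCategory B] (F : A ⥤ B) :
    Prop :=
  ∃ e : ContinuousMap.HomotopyEquiv (SSet.toTop.obj (nerve A)) (SSet.toTop.obj (nerve B)),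
    e.toFun = (SSet.toTop.map (nerveMap F)).hom

/-- The global weak equivalences of parsummable categories. -/
def globalWeakEquivalences : MorphismProperty ParSumCat.{u} :=
  fun _ _ F => ∀ G : UniversalSubgroup, IsWeakHomotopyEquivalence (F.2.fixed G.group)

end ParSumCat

/-! ### Permutative categories and the functor `Φ` -/

section Phi

/-- A small permutative category: a small symmetric monoidal category whose associativity and
unitality isomorphisms are identities. -/
structure PermCat : Type (u + 1) where
  carrier : Type u
  [category : SmallCategory carrier]
  [monoidal : MonoidalCategory carrier]
  [symmetric : SymmetricCategory carrier]
  tensor_assoc (X Y Z : carrier) : (X ⊗ Y) ⊗ Z = X ⊗ (Y ⊗ Z)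
  associator_eq (X Y Z : carrier) : (α_ X Y Z).hom = eqToHom (tensor_assoc X Y Z)
  unit_tensor (X : carrier) : 𝟙_ carrier ⊗ X = X
  leftUnitor_eq (X : carrier) : (λ_ X).hom = eqToHom (unit_tensor X)
  tensor_unit (X : carrier) : X ⊗ 𝟙_ carrier = X
  rightUnitor_eq (X : carrier) : (ρ_ X).hom = eqToHom (tensor_unit X)

attribute [instance] PermCat.category PermCat.monoidal PermCat.symmetric

variable (D : Type u) [Category.{v} D] [MonoidalCategory D]

/-- A sequence `(X₁, X₂, …)` of objects almost all of which are the tensor unit. -/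
@[ext]
structure Seq where
  obj : Omega → D
  finite : {i | obj i ≠ 𝟙_ D}.Finite

namespace Seq

variable {D}

/-- The labelled list of those entries `X_i` that differ from the unit, in increasing order. -/
noncomputable def list (X : Seq D) : List (Omega × D) :=
  (X.finite.toFinset.sort (· ≤ ·)).map (fun i => (i, X.obj i))

/-- The formal tensor product of the entries different from the unit, in increasing order. -/
noncomputable abbrev formal (X : Seq D) : Formal D := Formal.ofList X.list

/-- The tensor product of all entries. -/
noncomputable abbrev tensorAll (X : Seq D) : D := X.formal.eval

/-- A morphism `X ⟶ Y` is a morphism `⨂ X_i ⟶ ⨂ Y_i` in `D`. -/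
@[ext]
structure Hom (X Y : Seq D) : Type v where
  val : X.tensorAll ⟶ Y.tensorAll

noncomputable instance : Category.{v} (Seq D) where
  Hom X Y := Hom X Y
  id X := ⟨𝟙 X.tensorAll⟩
  comp f g := ⟨f.val ≫ g.val⟩

theorem hom_ext {X Y : Seq D} {f g : X ⟶ Y} (h : f.val = g.val) : f = g := Hom.ext h

theorem id_val (X : Seq D) : Hom.val (𝟙 X) = 𝟙 X.tensorAll := rfl

theorem comp_val {X Y Z : Seq D} (f : X ⟶ Y) (g : Y ⟶ Z) : (f ≫ g).val = f.val ≫ g.val := rfl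

theorem mem_list (X : Seq D) (p : Omega × D) : p ∈ X.list ↔ p.2 = X.obj p.1 ∧ p.2 ≠ 𝟙_ D := by
  obtain ⟨i, x⟩ := p
  simp only [list, List.mem_map, Finset.mem_sort, Set.Finite.mem_toFinset, Set.mem_ofPred_eq,
    Prod.mk.injEq]
  constructor
  · rintro ⟨j, hj, rfl, rfl⟩; exact ⟨rfl, hj⟩
  · rintro ⟨rfl, h⟩; exact ⟨i, h, rfl, rfl⟩

theorem labels_formal (X : Seq D) : X.formal.labels = X.finite.toFinset.sort (· ≤ ·) := by
  rw [Formal.labels_eq, Formal.leaves_ofList, list, List.map_map]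
  exact List.map_id _

theorem nodup_labels (X : Seq D) : X.formal.labels.Nodup := by
  rw [labels_formal]; exact Finset.sort_nodup _ _

theorem nodup_list (X : Seq D) : X.list.Nodup := by
  refine List.Nodup.of_map Prod.fst ?_
  have := X.nodup_labels
  rwa [Formal.labels_eq, Formal.leaves_ofList] at this

/-- The sequence `u_* X`, with `(u_* X)_{u j} = X_j` and unit entries outside the image of `u`. -/
noncomputable instance : SMul M (Seq D) where
  smul a X :=
    { obj := Function.extend (fun i : Omega => a • i) X.obj (fun _ => 𝟙_ D)
      finite := by
        refine (X.finite.image (fun i => a • i)).subset fun i hi => ?_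
        by_cases h : ∃ j : Omega, a • j = i
        · obtain ⟨j, rfl⟩ := h
          refine ⟨j, ?_, rfl⟩
          have hi' : Function.extend (fun i : Omega => a • i) X.obj (fun _ => 𝟙_ D) (a • j) ≠ 𝟙_ D :=
            hi
          rwa [a.injective.extend_apply X.obj (fun _ => 𝟙_ D) j] at hi'
        · exact absurd (Function.extend_apply' _ _ _ h) hi }

theorem smul_obj_smul (a : M) (X : Seq D) (i : Omega) : (a • X).obj (a • i) = X.obj i :=
  a.injective.extend_apply X.obj (fun _ => 𝟙_ D) i

theorem smul_obj_of_not (a : M) (X : Seq D) (i : Omega) (h : ¬ ∃ j : Omega, a • j = i) :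
    (a • X).obj i = 𝟙_ D :=
  Function.extend_apply' X.obj (fun _ => 𝟙_ D) i h

noncomputable instance : MulAction M (Seq D) where
  one_smul X := Seq.ext (funext fun i => smul_obj_smul 1 X i)
  mul_smul a b X := by
    refine Seq.ext (funext fun i => ?_)
    by_cases h : ∃ j : Omega, a • j = i
    · obtain ⟨j, rfl⟩ := h
      rw [smul_obj_smul]
      by_cases h' : ∃ k : Omega, b • k = j
      · obtain ⟨k, rfl⟩ := h'
        rw [smul_obj_smul, ← mul_smul, smul_obj_smul]
      · rw [smul_obj_of_not b X j h', smul_obj_of_not]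
        rintro ⟨k, hk⟩
        rw [mul_smul] at hk
        exact h' ⟨k, a.injective hk⟩
    · rw [smul_obj_of_not a _ i h, smul_obj_of_not]
      rintro ⟨k, hk⟩
      exact h ⟨b • k, by rw [← mul_smul, hk]⟩

theorem leaves_smul (a : M) (X : Seq D) : (a • X).formal.leaves.Perm
    (X.formal.leaves.map (Prod.map (fun i => a • i) _root_.id)) := by
  rw [Formal.leaves_ofList, Formal.leaves_ofList, List.perm_ext_iff_of_nodup (nodup_list _)
    ((List.nodup_map_iff (Function.Injective.prodMap a.injective Function.injective_id)).mpr
      (nodup_list _))]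
  rintro ⟨i, x⟩
  simp only [mem_list, List.mem_map, Prod.exists, Prod.map_apply, _root_.id, Prod.mk.injEq]
  constructor
  · rintro ⟨h, h'⟩
    by_cases hi : ∃ j : Omega, a • j = i
    · obtain ⟨j, rfl⟩ := hi
      rw [smul_obj_smul] at h
      exact ⟨j, x, ⟨h, h'⟩, rfl, rfl⟩
    · rw [smul_obj_of_not a X i hi] at h
      exact absurd h h'
  · rintro ⟨j, y, ⟨h, h'⟩, rfl, rfl⟩
    exact ⟨by rw [smul_obj_smul, h], h'⟩

variable [SymmetricCategory D]

/-- The isomorphism `X ≅ u_* X`: the coherence isomorphism that moves the factor `X_i` to the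
position `u i`. -/
noncomputable def circ (a : M) (X : Seq D) : X ≅ a • X where
  hom := ⟨(cohIso (leaves_smul a X)).hom⟩
  inv := ⟨(cohIso (leaves_smul a X)).inv⟩
  hom_inv_id := hom_ext (cohIso (leaves_smul a X)).hom_inv_id
  inv_hom_id := hom_ext (cohIso (leaves_smul a X)).inv_hom_id

theorem coh_circ (a : M) (X : Seq D) :
    Coh (fun i => a • i) X.formal (a • X).formal (circ a X).hom.val := coh_cohIso _

theorem coh_eqToHom {X Y : Seq D} (h : X = Y) :
    Coh _root_.id X.formal Y.formal (eqToHom h : X ⟶ Y).val := by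
  subst h; exact Coh.refl _

noncomputable instance : EMCat (Seq D) where
  circ := circ
  circ_mul a b X := by
    have h := Coh.comp (coh_circ b X) ((coh_circ a (b • X)).comp_id
      (coh_eqToHom (mul_smul a b X).symm))
    exact hom_ext ((coh_circ (a * b) X).unique h (nodup_labels _))

open EMCat

theorem isSupportedOn (X : Seq D) : IsSupportedOn X X.finite.toFinset := by
  intro a ha
  refine Seq.ext (funext fun i => ?_)
  by_cases h : ∃ j : Omega, a • j = i
  · obtain ⟨j, rfl⟩ := h
    rw [smul_obj_smul]
    by_cases hj : X.obj j = 𝟙_ D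
    · by_contra hne
      have hj' : X.obj (a • j) ≠ 𝟙_ D := fun h => hne (hj.trans h.symm)
      have := a.injective (ha (a • j) (by simpa using hj'))
      rw [this] at hj'
      exact hj' hj
    · rw [ha j (by simpa using hj)]
  · rw [smul_obj_of_not a X i h]
    by_contra hne
    exact h ⟨i, ha i (by simpa using fun h => hne h.symm)⟩

/-- The support of `X` is the set of all `i` such that `X_i` differs from the unit. -/
theorem supp_eq (X : Seq D) : supp X = {i | X.obj i ≠ 𝟙_ D} := by
  classical
  refine subset_antisymm ((supp_subset X.isSupportedOn).trans (by simp)) fun i hi A hA => ?_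
  by_contra hiA
  obtain ⟨k, hk⟩ := Infinite.exists_notMem_finset (A ∪ {i} ∪ X.finite.toFinset)
  simp only [Finset.mem_union, Finset.mem_singleton, Set.Finite.mem_toFinset, Set.mem_ofPred_eq,
    not_or, not_not] at hk
  let a : M := ⟨(Equiv.swap i k : Omega → Omega), (Equiv.swap i k).injective⟩
  have ha : a • X = X := hA a fun j hj => by
    change Equiv.swap i k j = j
    refine Equiv.swap_apply_of_ne_of_ne ?_ ?_
    · rintro rfl; exact hiA hj
    · rintro rfl; exact hk.1.1 hj
  have h1 := smul_obj_smul a X i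
  have h2 : a • i = k := Equiv.swap_apply_left i k
  rw [ha, h2, hk.2] at h1
  exact hi h1.symm

open Classical in
/-- The sum: `(X + Y)_i = X_i` if `i` lies in the support of `X`, and `Y_i` otherwise. -/
noncomputable def add (X Y : Seq D) : Seq D where
  obj i := if X.obj i ≠ 𝟙_ D then X.obj i else Y.obj i
  finite := by
    refine (X.finite.union Y.finite).subset fun i hi => ?_
    by_cases h : X.obj i = 𝟙_ D
    · right; simpa [h] using hi
    · left; exact h

theorem add_obj_left {X : Seq D} (Y : Seq D) {i : Omega} (h : X.obj i ≠ 𝟙_ D) :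
    (add X Y).obj i = X.obj i := if_pos h

theorem add_obj_right {X : Seq D} (Y : Seq D) {i : Omega} (h : X.obj i = 𝟙_ D) :
    (add X Y).obj i = Y.obj i := if_neg (not_not.mpr h)

theorem eq_or {X Y : Seq D} (h : Disjoint (supp X) (supp Y)) (i : Omega) :
    X.obj i = 𝟙_ D ∨ Y.obj i = 𝟙_ D := by
  rw [supp_eq, supp_eq, Set.disjoint_left] at h
  by_contra hn
  rw [not_or] at hn
  exact h hn.1 hn.2

theorem leaves_add {X Y : Seq D} (h : Disjoint (supp X) (supp Y)) :
    (X.formal.tensor Y.formal).leaves.Perm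
      ((add X Y).formal.leaves.map (Prod.map _root_.id _root_.id)) := by
  have hd : X.list.Disjoint Y.list := by
    rintro ⟨i, x⟩ hx hy
    rw [mem_list] at hx hy
    rcases eq_or h i with h | h
    · exact hx.2 (hx.1.trans h)
    · exact hy.2 (hy.1.trans h)
  rw [Prod.map_id, List.map_id, Formal.leaves, Formal.leaves_ofList, Formal.leaves_ofList,
    Formal.leaves_ofList, List.perm_ext_iff_of_nodup
      (List.nodup_append'.mpr ⟨nodup_list _, nodup_list _, hd⟩) (nodup_list _)]
  rintro ⟨i, x⟩
  simp only [List.mem_append, mem_list]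
  by_cases hX : X.obj i = 𝟙_ D
  · rw [add_obj_right Y hX, hX]
    constructor
    · rintro (h | h)
      · exact absurd h.1 h.2
      · exact h
    · exact Or.inr
  · rw [add_obj_left Y hX, (eq_or h i).resolve_left hX]
    constructor
    · rintro (h | h)
      · exact h
      · exact absurd h.1 h.2
    · exact Or.inl

/-- The coherence isomorphism `⨂ (X + Y)_i ≅ ⨂ X_i ⊗ ⨂ Y_i`. -/
noncomputable def split {X Y : Seq D} (h : Disjoint (supp X) (supp Y)) :
    (add X Y).tensorAll ≅ X.tensorAll ⊗ Y.tensorAll :=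
  cohIso (u := _root_.id) (e' := X.formal.tensor Y.formal) (leaves_add h)

theorem coh_split {X Y : Seq D} (h : Disjoint (supp X) (supp Y)) :
    Coh _root_.id (add X Y).formal (X.formal.tensor Y.formal) (split h).hom := coh_cohIso _

theorem nodup_tensor {X Y : Seq D} (h : Disjoint (supp X) (supp Y)) :
    (X.formal.tensor Y.formal).labels.Nodup := by
  have := (coh_split h).labels_perm
  rw [List.map_id] at this
  exact this.nodup_iff.mpr (nodup_labels _)

/-- The sum of morphisms. -/
noncomputable def addHom {X X' Y Y' : Seq D} (f : X ⟶ X') (g : Y ⟶ Y')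
    (h : Disjoint (supp X) (supp Y)) (h' : Disjoint (supp X') (supp Y')) : add X Y ⟶ add X' Y' :=
  ⟨(split h).hom ≫ (f.val ⊗ₘ g.val) ≫ (split h').inv⟩

/-- The sequence all of whose entries are the unit. -/
def zero : Seq D := ⟨fun _ => 𝟙_ D, by simp⟩

theorem add_zero (X : Seq D) : add X zero = X := by
  refine Seq.ext (funext fun i => ?_)
  by_cases h : X.obj i = 𝟙_ D
  · rw [add_obj_right _ h, h]; rfl
  · rw [add_obj_left _ h]

theorem add_comm {X Y : Seq D} (h : Disjoint (supp X) (supp Y)) : add X Y = add Y X := by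
  refine Seq.ext (funext fun i => ?_)
  by_cases hX : X.obj i = 𝟙_ D
  · rw [add_obj_right _ hX]
    by_cases hY : Y.obj i = 𝟙_ D
    · rw [add_obj_right _ hY, hX, hY]
    · rw [add_obj_left _ hY]
  · rw [add_obj_left _ hX, add_obj_right _ ((eq_or h i).resolve_left hX)]

theorem add_assoc (X Y Z : Seq D) : add (add X Y) Z = add X (add Y Z) := by
  refine Seq.ext (funext fun i => ?_)
  by_cases hX : X.obj i = 𝟙_ D
  · rw [add_obj_right _ hX]
    by_cases hY : Y.obj i = 𝟙_ D
    · rw [add_obj_right _ hY, add_obj_right _ (by rw [add_obj_right _ hX, hY])]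
    · rw [add_obj_left _ hY, add_obj_left _ (by rwa [add_obj_right _ hX]), add_obj_right _ hX]
  · rw [add_obj_left _ hX, add_obj_left _ (by rwa [add_obj_left _ hX]), add_obj_left _ hX]

theorem smul_add (a : M) (X Y : Seq D) : a • add X Y = add (a • X) (a • Y) := by
  refine Seq.ext (funext fun i => ?_)
  by_cases h : ∃ j : Omega, a • j = i
  · obtain ⟨j, rfl⟩ := h
    rw [smul_obj_smul]
    by_cases hX : X.obj j = 𝟙_ D
    · rw [add_obj_right _ hX, add_obj_right _ (by rwa [smul_obj_smul]), smul_obj_smul]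
    · rw [add_obj_left _ hX, add_obj_left _ (by rwa [smul_obj_smul]), smul_obj_smul]
  · rw [smul_obj_of_not a _ i h, add_obj_right _ (smul_obj_of_not a _ i h),
      smul_obj_of_not a _ i h]

theorem formal_zero : (zero : Seq D).formal = Formal.unit := by
  have : (zero : Seq D).list = [] := List.eq_nil_iff_forall_not_mem.mpr fun p hp => by
    rw [mem_list] at hp
    exact hp.2 hp.1
  rw [formal, this]; rfl

theorem eqToHom_val_symm {X Y : Seq D} (h : X = Y) :
    (eqToHom h).val ≫ (eqToHom h.symm).val = 𝟙 _ := by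
  subst h; exact Category.comp_id _

theorem split_zero (X : Seq D) (h : Disjoint (supp X) (supp (zero : Seq D))) :
    (split h).hom ≫ _ ◁ eqToHom (congrArg Formal.eval formal_zero) ≫ (ρ_ X.tensorAll).hom =
      (eqToHom (add_zero X)).val := by
  refine Coh.unique (u := _root_.id) (e' := X.formal) ?_ (coh_eqToHom _) (nodup_labels X)
  refine (coh_split h).comp_id (Coh.comp_id ?_ (Coh.right_unitor X.formal))
  rw [← id_tensorHom]
  exact Coh.tensor (Coh.refl _) (Coh.of_eq formal_zero)

theorem split_comm {X Y : Seq D} (h : Disjoint (supp X) (supp Y)) :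
    (split h).hom ≫ (β_ X.tensorAll Y.tensorAll).hom =
      (eqToHom (add_comm h)).val ≫ (split h.symm).hom :=
  Coh.unique (u := _root_.id) (e' := Y.formal.tensor X.formal)
    ((coh_split h).comp_id (Coh.braiding X.formal Y.formal))
    ((coh_eqToHom _).comp_id (coh_split h.symm)) (nodup_tensor h.symm)

theorem split_assoc {X Y Z : Seq D} (hXY : Disjoint (supp X) (supp Y))
    (hYZ : Disjoint (supp Y) (supp Z)) (h₁ : Disjoint (supp (add X Y)) (supp Z))
    (h₂ : Disjoint (supp X) (supp (add Y Z))) :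
    (split h₁).hom ≫ (split hXY).hom ▷ Z.tensorAll ≫
        (α_ X.tensorAll Y.tensorAll Z.tensorAll).hom =
      (eqToHom (add_assoc X Y Z)).val ≫ (split h₂).hom ≫ X.tensorAll ◁ (split hYZ).hom := by
  have key : Coh _root_.id (add (add X Y) Z).formal
      (X.formal.tensor (Y.formal.tensor Z.formal))
      ((eqToHom (add_assoc X Y Z)).val ≫ (split h₂).hom ≫ X.tensorAll ◁ (split hYZ).hom) := by
    rw [← id_tensorHom]
    exact (coh_eqToHom _).comp_id ((coh_split h₂).comp_id
      (Coh.tensor (Coh.refl X.formal) (coh_split hYZ)))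
  refine Coh.unique ?_ key ?_
  · rw [← tensorHom_id]
    exact (coh_split h₁).comp_id (Coh.comp_id (Coh.tensor (coh_split hXY) (Coh.refl Z.formal))
      (Coh.assoc X.formal Y.formal Z.formal))
  · have := key.labels_perm
    rw [List.map_id] at this
    exact this.nodup_iff.mpr (nodup_labels _)

theorem split_circ (a : M) {X Y : Seq D} (h : Disjoint (supp X) (supp Y))
    (h' : Disjoint (supp (a • X)) (supp (a • Y))) :
    ((circ a (add X Y)).hom.val ≫ (eqToHom (smul_add a X Y)).val) ≫ (split h').hom =
      (split h).hom ≫ ((circ a X).hom.val ⊗ₘ (circ a Y).hom.val) :=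
  Coh.unique (u := fun i => a • i) (e' := (a • X).formal.tensor (a • Y).formal)
    (((coh_circ a _).comp_id (coh_eqToHom _)).comp_id (coh_split h'))
    ((coh_split h).id_comp (Coh.tensor (coh_circ a X) (coh_circ a Y))) (nodup_tensor h')

noncomputable instance : Parsummable (Seq D) where
  tame X := ⟨_, X.isSupportedOn⟩
  zero := zero
  smul_zero a := by
    refine Seq.ext (funext fun i => ?_)
    by_cases h : ∃ j : Omega, a • j = i
    · obtain ⟨j, rfl⟩ := h
      rw [smul_obj_smul]; rfl
    · rw [smul_obj_of_not a _ i h]; rfl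
  add X Y _ := add X Y
  add_zero X _ := add_zero X
  add_comm X Y h := add_comm h
  add_assoc X Y Z _ _ _ _ _ := add_assoc X Y Z
  smul_add a X Y _ _ := smul_add a X Y
  addHom := addHom
  addHom_id X Y h := hom_ext (by simp [addHom, id_val])
  addHom_comp f f' g g' h h' h'' := hom_ext (by simp [addHom, comp_val])
  addHom_zero {X X'} f h h' := hom_ext (by
    simp only [addHom, id_val, comp_val, tensorHom_id]
    rw [← Category.assoc, Iso.comp_inv_eq, ← cancel_mono
      (_ ◁ eqToHom (congrArg Formal.eval formal_zero) ≫ (ρ_ X'.tensorAll).hom)]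
    simp only [Category.assoc]
    rw [split_zero X' h', eqToHom_val_symm, Category.comp_id, ← split_zero X h,
      ← whisker_exchange_assoc]
    simp)
  addHom_comm {X X' Y Y'} f g h h' := hom_ext (by
    simp only [addHom, comp_val]
    have e1 := split_comm h
    have e2 := split_comm h'
    simp only [Category.assoc]
    rw [← reassoc_of% e1, ← Category.assoc, Iso.comp_inv_eq, ← cancel_mono (β_ _ _).hom]
    simp only [Category.assoc]
    rw [e2, reassoc_of% (eqToHom_val_symm (add_comm h').symm)]
    simp)
  addHom_assoc {X X' Y Y' Z Z'} f g k hXY hYZ hXZ h₁ h₂ hXY' hYZ' hXZ' h₁' h₂' := hom_ext (by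
    simp only [addHom, comp_val]
    have e1 := split_assoc hXY hYZ h₁ h₂
    have e2 := split_assoc hXY' hYZ' h₁' h₂'
    rw [← Category.assoc, Iso.comp_inv_eq, ← cancel_mono ((split hXY').hom ▷ Z'.tensorAll ≫
      (α_ X'.tensorAll Y'.tensorAll Z'.tensorAll).hom)]
    simp only [Category.assoc]
    rw [e2, reassoc_of% (eqToHom_val_symm (add_assoc X' Y' Z').symm)]
    have r₁ : (f.val ⊗ₘ (split hYZ).hom ≫ (g.val ⊗ₘ k.val) ≫ (split hYZ').inv) =
        _ ◁ (split hYZ).hom ≫ (f.val ⊗ₘ (g.val ⊗ₘ k.val)) ≫ _ ◁ (split hYZ').inv := by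
      simp only [← id_tensorHom, tensorHom_comp_tensorHom, Category.id_comp, Category.comp_id]
    have r₂ : ((split hXY).hom ≫ (f.val ⊗ₘ g.val) ≫ (split hXY').inv ⊗ₘ k.val) =
        (split hXY).hom ▷ _ ≫ ((f.val ⊗ₘ g.val) ⊗ₘ k.val) ≫ (split hXY').inv ▷ _ := by
      simp only [← tensorHom_id, tensorHom_comp_tensorHom, Category.id_comp, Category.comp_id]
    rw [r₁, r₂]
    simp only [Category.assoc]
    rw [← reassoc_of% e1]
    simp)
  circ_add a X Y h h' := hom_ext (by
    change (circ a (add X Y)).hom.val ≫ (eqToHom (smul_add a X Y)).val = _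
    have := split_circ a h h'
    rw [← Iso.eq_comp_inv, Category.assoc] at this
    exact this)

end Seq

end Phi

/-- The parsummable category `Φ D` of a permutative category `D`. -/
noncomputable def Phi (D : PermCat.{u}) : ParSumCat.{u} where
  carrier := Seq D.carrier

/-! ### The comparison homomorphisms `a_G` -/

namespace PermCat

variable (D : PermCat.{u})

/-- The set `π₀ D` of path components of a permutative category. -/
def Pi0 : Type u := ConnectedComponents D.carrier

variable {D}

/-- The class of an object in `π₀ D`. -/
def Pi0.mk (X : D.carrier) : D.Pi0 := Quotient.mk'' X

theorem Pi0.mk_eq {X Y : D.carrier} : Pi0.mk X = Pi0.mk Y ↔ Zigzag X Y := Quotient.eq''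

/-- The commutative monoid structure on `π₀ D`, written additively: `[X] + [Y] = [X ⊗ Y]`. -/
noncomputable instance : AddCommMonoid D.Pi0 where
  add := Quotient.map₂ (fun X Y : D.carrier => X ⊗ Y) (fun X X' zX Y Y' zY =>
    (zigzag_obj_of_zigzag (tensorRight Y) zX).trans (zigzag_obj_of_zigzag (tensorLeft X') zY))
  zero := Pi0.mk (𝟙_ D.carrier)
  nsmul := @nsmulRec _ ⟨Pi0.mk (𝟙_ D.carrier)⟩ ⟨Quotient.map₂ (fun X Y : D.carrier => X ⊗ Y)
    (fun X X' zX Y Y' zY =>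
      (zigzag_obj_of_zigzag (tensorRight Y) zX).trans (zigzag_obj_of_zigzag (tensorLeft X') zY))⟩
  add_zero x := by
    obtain ⟨X, rfl⟩ := Quotient.exists_rep x
    exact Pi0.mk_eq.mpr (Zigzag.of_hom (ρ_ X).hom)
  zero_add x := by
    obtain ⟨X, rfl⟩ := Quotient.exists_rep x
    exact Pi0.mk_eq.mpr (Zigzag.of_hom (λ_ X).hom)
  add_comm x y := by
    obtain ⟨X, rfl⟩ := Quotient.exists_rep x
    obtain ⟨Y, rfl⟩ := Quotient.exists_rep y
    exact Pi0.mk_eq.mpr (Zigzag.of_hom (β_ X Y).hom)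
  add_assoc x y z := by
    obtain ⟨X, rfl⟩ := Quotient.exists_rep x
    obtain ⟨Y, rfl⟩ := Quotient.exists_rep y
    obtain ⟨Z, rfl⟩ := Quotient.exists_rep z
    exact Pi0.mk_eq.mpr (Zigzag.of_hom (α_ X Y Z).hom)

end PermCat

/-- Transitive (in particular non-empty) `G`-sets. As `G` is finite, so are these. -/
structure TransitiveSet (G : UniversalSubgroup) : Type 1 where
  carrier : Type
  [action : MulAction G.group carrier]
  [transitive : MulAction.IsPretransitive G.group carrier]
  [nonempty : Nonempty carrier]

attribute [instance] TransitiveSet.action TransitiveSet.transitive TransitiveSet.nonempty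

/-- The relation of being isomorphic as `G`-sets. -/
instance TransitiveSet.setoid (G : UniversalSubgroup) : Setoid (TransitiveSet G) where
  r S T := ∃ e : S.carrier ≃ T.carrier, ∀ (g : G.group) (s : S.carrier), e (g • s) = g • e s
  iseqv :=
    { refl := fun S => ⟨Equiv.refl _, fun _ _ => rfl⟩
      symm := fun ⟨e, he⟩ => ⟨e.symm, fun g t => by
        rw [Equiv.symm_apply_eq, he, Equiv.apply_symm_apply]⟩
      trans := fun ⟨e, he⟩ ⟨e', he'⟩ => ⟨e.trans e', fun g s => by simp [he, he']⟩ }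

/-- Isomorphism classes of transitive `G`-sets. -/
abbrev TransitiveClass (G : UniversalSubgroup) : Type 1 := Quotient (TransitiveSet.setoid G)

open Classical in
/-- The object `Π(X, S)` with entries `X` at the positions in `S` and the unit elsewhere. -/
noncomputable def constSeq {D : Type u} [Category.{v} D] [MonoidalCategory D] (X : D)
    (S : Set Omega) (hS : S.Finite) : Seq D where
  obj i := if i ∈ S then X else 𝟙_ D
  finite := hS.subset fun i hi => by
    by_contra h
    exact hi (if_neg h)

/-- The object `Π(X, S)` for a `G`-stable set `S`, as a `G`-fixed object of `Φ D`. -/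
noncomputable def fixedConstSeq {D : PermCat.{u}} {G : UniversalSubgroup} (X : D.carrier)
    (S : SubMulAction G.group Omega) (hS : (S : Set Omega).Finite) :
    Fixed G.group (Phi D).carrier where
  obj := constSeq X S hS
  smul_eq g hg := by
    refine Seq.ext (funext fun i => ?_)
    obtain ⟨j, rfl⟩ : ∃ j : Omega, (g : M) • j = i :=
      ⟨((g⁻¹ : Mˣ) : M) • i, by rw [← mul_smul, Units.mul_inv, one_smul]⟩
    refine (Seq.smul_obj_smul (g : M) (constSeq X S hS) j).trans ?_
    have h : j ∈ (S : Set Omega) ↔ (g : M) • j ∈ (S : Set Omega) :=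
      (S.smul_mem_iff' (⟨g, hg⟩ : G.group)).symm
    classical exact if_congr h rfl rfl

open Classical in
/-- The defining property of the homomorphism `a_G` from the product of copies of `π₀ D`, indexed
by the isomorphism classes of transitive `G`-sets, to `π₀ ((Φ D)^G)`: on the factor belonging to
the class of `T` it sends `[X]` to `[Π(X, S)]`, for any `S ⊆ ω` that represents this class. -/
def IsComparison {D : PermCat.{u}} {G : UniversalSubgroup}
    (a : (TransitiveClass G → D.Pi0) →+ (Phi D).FixedPi0 G) : Prop :=
  ∀ (T : TransitiveSet G) (S : SubMulAction G.group Omega) (hS : (S : Set Omega).Finite)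
    (e : S ≃ T.carrier), (∀ (g : G.group) (s : S), e (g • s) = g • e s) →
    ∀ X : D.carrier, a (Pi.single (Quotient.mk _ T) (PermCat.Pi0.mk X)) =
      ParSumCat.FixedPi0.mk (fixedConstSeq X S hS)

end ParSum

/-! A `G`-fixed sequence is constant along the `G`-orbits of `ω`. It is therefore a finite sum of
sequences `Π(X, S)` with `S` a single orbit, and this is the surjectivity of `a_G`
(`IsComparison.mk_mem_range`).

For `a_G` to exist, the class of `Π(X, S)` may depend only on the class of `X` and on the `G`-set
`S`, and it must be additive in `X`. The morphisms that show this are `f^{⊗S}`, reindexed along an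
isomorphism `S ≃ S'`, and the regrouping `(X ⊗ Y)^{⊗S} ≅ X^{⊗S} ⊗ Y^{⊗S'}`. The point is that they
are `G`-fixed, that is, commute with the coherence isomorphisms by which `G` permutes the factors.
Both are cases of one principle: replacing every factor of a formal product by a morphism into
another formal product is natural for coherence isomorphisms (`Coh.subst`), and coherence
isomorphisms are determined by their effect on distinct labels (`Coh.unique`).
`Fixed.exists_isEquivariant` and `Fixed.IsEquivariant.nonempty_hom` turn this into fixed morphisms.
If `G` is trivial, there is only one transitive `G`-set, and tensoring all entries inverts `a_G`.

The first claim is then a count of ranks. The tensor product of all entries makes `π₀ D` a quotient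
of `π₀ (Φ D) ≅ ℕ`, and a group of order three has at most two transitive sets up to isomorphism, so
`ℕ³` would be a quotient of `ℕ²` or of a smaller power, which is impossible over `ℚ`.

For the third claim, maps from classifying spaces to a discrete space with two points show that `π₀
(C^G)` is an invariant of the localization (`nonempty_fixedPi0_equiv`). By the second claim, if `π₀
((Φ D)^E)` is trivial for the trivial group `E`, then so is `π₀ ((Φ D)^G)` for all universal `G`.
The category `PairSum` violates this: any two of its objects are joined by a morphism, but its
structure isomorphisms record the parity of the number of pairs whose order is reversed, and for an
involution this parity separates components of the fixed points. -/

namespace ParSum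

/-! ### Substitution into formal tensor products. -/

section Substitution

variable {D : Type u} [Category.{v} D] [MonoidalCategory D]

/-- A formal tensor product together with a morphism from `x` to the object that it denotes. -/
structure Target (x : D) where
  form : Formal D
  hom : x ⟶ form.eval

namespace Formal

/-- Substitution of formal tensor products for the factors of a formal tensor product. -/
def subst (φ : Omega → (x : D) → Target x) : (e : Formal D) → Target e.eval
  | unit => ⟨unit, 𝟙 _⟩
  | leaf i x => φ i x
  | tensor a b => ⟨tensor (a.subst φ).form (b.subst φ).form, (a.subst φ).hom ⊗ₘ (b.subst φ).hom⟩

theorem isIso_subst {φ : Omega → (x : D) → Target x} (e : Formal D)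
    (h : ∀ p ∈ e.leaves, IsIso (φ p.1 p.2).hom) : IsIso (e.subst φ).hom := by
  induction e with
  | unit => exact inferInstanceAs (IsIso (𝟙 (𝟙_ D)))
  | leaf i x => exact h (i, x) (by simp [leaves])
  | tensor a b iha ihb =>
    have := iha fun p hp => h p (by simp [leaves, hp])
    have := ihb fun p hp => h p (by simp [leaves, hp])
    exact inferInstanceAs (IsIso ((a.subst φ).hom ⊗ₘ (b.subst φ).hom))

theorem leaves_subst (φ : Omega → (x : D) → Target x) (e : Formal D) :
    (e.subst φ).form.leaves = e.leaves.flatMap fun p => (φ p.1 p.2).form.leaves := by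
  induction e with
  | unit => rfl
  | leaf i x => simp [subst, leaves]
  | tensor a b iha ihb => simp [subst, leaves, iha, ihb]

end Formal

variable [SymmetricCategory D]

/-- The morphisms `s.hom` and `t.hom` differ by a coherence morphism over `w`. -/
def Target.Compat {x : D} (w : Omega → Omega) (s t : Target x) : Prop :=
  ∃ k : s.form.eval ⟶ t.form.eval, Coh w s.form t.form k ∧ s.hom ≫ k = t.hom

theorem Target.Compat.refl {x : D} (s : Target x) : s.Compat id s :=
  ⟨𝟙 _, Coh.refl _, Category.comp_id _⟩

open Formal

/-- This is the case of `Coh.subst` in which the outer coherence morphism is an identity. The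
structural isomorphisms reduce to it by naturality. -/
theorem Formal.subst_compat {w : Omega → Omega} {φ ψ : Omega → (x : D) → Target x} (e : Formal D)
    (h : ∀ p ∈ e.leaves, (φ p.1 p.2).Compat w (ψ p.1 p.2)) :
    (e.subst φ).Compat w (e.subst ψ) := by
  induction e with
  | unit => exact ⟨𝟙 _, Coh.unit w, Category.comp_id _⟩
  | leaf i x => exact h (i, x) (by simp [leaves])
  | tensor a b iha ihb =>
    obtain ⟨f, hf, hf'⟩ := iha fun p hp => h p (by simp [leaves, hp])
    obtain ⟨g, hg, hg'⟩ := ihb fun p hp => h p (by simp [leaves, hp])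
    refine ⟨f ⊗ₘ g, Coh.tensor hf hg, ?_⟩
    change ((a.subst φ).hom ⊗ₘ (b.subst φ).hom) ≫ (f ⊗ₘ g) = (a.subst ψ).hom ⊗ₘ (b.subst ψ).hom
    rw [tensorHom_comp_tensorHom, hf', hg']

/-- Substitution is natural for coherence morphisms. -/
theorem Coh.subst {u : Omega → Omega} {e e' : Formal D} {f : e.eval ⟶ e'.eval}
    (h : Coh u e e' f) (he : e'.labels.Nodup) {w : Omega → Omega}
    {φ ψ : Omega → (x : D) → Target x}
    (hφ : ∀ p ∈ e.leaves, (φ p.1 p.2).Compat w (ψ (u p.1) p.2)) :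
    ∃ k : (e.subst φ).form.eval ⟶ (e'.subst ψ).form.eval,
      Coh w (e.subst φ).form (e'.subst ψ).form k ∧
        (e.subst φ).hom ≫ k = f ≫ (e'.subst ψ).hom := by
  induction h generalizing w φ ψ with
  | unit u => exact ⟨𝟙 _, Coh.unit w, (Category.comp_id _).trans (Category.id_comp _).symm⟩
  | leaf u i x =>
    obtain ⟨k, hk, hk'⟩ := hφ (i, x) (by simp [leaves])
    exact ⟨k, hk, hk'.trans (Category.id_comp _).symm⟩
  | @tensor u a a' b b' f g _ _ hf hg =>
    simp only [Formal.labels] at he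
    obtain ⟨k, hk, hk'⟩ := hf he.of_append_left (w := w) (φ := φ) (ψ := ψ)
      fun p hp => hφ p (by simp [leaves, hp])
    obtain ⟨l, hl, hl'⟩ := hg he.of_append_right (w := w) (φ := φ) (ψ := ψ)
      fun p hp => hφ p (by simp [leaves, hp])
    refine ⟨k ⊗ₘ l, Coh.tensor hk hl, ?_⟩
    change ((a.subst φ).hom ⊗ₘ (b.subst φ).hom) ≫ (k ⊗ₘ l) =
      (f ⊗ₘ g) ≫ ((a'.subst ψ).hom ⊗ₘ (b'.subst ψ).hom)
    rw [tensorHom_comp_tensorHom, tensorHom_comp_tensorHom, hk', hl']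
  -- The structural isomorphisms do not move labels: pass from `φ` to `ψ` on the source, then apply
  -- naturality of the isomorphism. The next six cases are alike.
  | assoc a b c =>
    obtain ⟨k, hk, hk'⟩ := Formal.subst_compat _ hφ
    refine ⟨k ≫ (α_ _ _ _).hom, hk.comp_id (Coh.assoc _ _ _),
      (Category.assoc _ _ _).symm.trans ((congrArg (· ≫ (α_ _ _ _).hom) hk').trans ?_)⟩
    exact associator_naturality _ _ _
  | assoc_inv a b c =>
    obtain ⟨k, hk, hk'⟩ := Formal.subst_compat _ hφ
    refine ⟨k ≫ (α_ _ _ _).inv, hk.comp_id (Coh.assoc_inv _ _ _),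
      (Category.assoc _ _ _).symm.trans ((congrArg (· ≫ (α_ _ _ _).inv) hk').trans ?_)⟩
    exact associator_inv_naturality _ _ _
  | left_unitor a =>
    obtain ⟨k, hk, hk'⟩ := Formal.subst_compat _ hφ
    refine ⟨k ≫ (λ_ _).hom, hk.comp_id (Coh.left_unitor _),
      (Category.assoc _ _ _).symm.trans ((congrArg (· ≫ (λ_ _).hom) hk').trans ?_)⟩
    change (𝟙 (𝟙_ D) ⊗ₘ (a.subst ψ).hom) ≫ _ = _
    rw [id_tensorHom, leftUnitor_naturality]
  | left_unitor_inv a =>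
    obtain ⟨k, hk, hk'⟩ := Formal.subst_compat _ hφ
    refine ⟨k ≫ (λ_ _).inv, hk.comp_id (Coh.left_unitor_inv _),
      (Category.assoc _ _ _).symm.trans ((congrArg (· ≫ (λ_ _).inv) hk').trans ?_)⟩
    change _ = _ ≫ (𝟙 (𝟙_ D) ⊗ₘ (a.subst ψ).hom)
    rw [id_tensorHom, leftUnitor_inv_naturality]
  | right_unitor a =>
    obtain ⟨k, hk, hk'⟩ := Formal.subst_compat _ hφ
    refine ⟨k ≫ (ρ_ _).hom, hk.comp_id (Coh.right_unitor _),
      (Category.assoc _ _ _).symm.trans ((congrArg (· ≫ (ρ_ _).hom) hk').trans ?_)⟩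
    change ((a.subst ψ).hom ⊗ₘ 𝟙 (𝟙_ D)) ≫ _ = _
    rw [tensorHom_id, rightUnitor_naturality]
  | right_unitor_inv a =>
    obtain ⟨k, hk, hk'⟩ := Formal.subst_compat _ hφ
    refine ⟨k ≫ (ρ_ _).inv, hk.comp_id (Coh.right_unitor_inv _),
      (Category.assoc _ _ _).symm.trans ((congrArg (· ≫ (ρ_ _).inv) hk').trans ?_)⟩
    change _ = _ ≫ ((a.subst ψ).hom ⊗ₘ 𝟙 (𝟙_ D))
    rw [tensorHom_id, rightUnitor_inv_naturality]
  | braiding a b =>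
    obtain ⟨k, hk, hk'⟩ := Formal.subst_compat _ hφ
    refine ⟨k ≫ (β_ _ _).hom, hk.comp_id (Coh.braiding _ _),
      (Category.assoc _ _ _).symm.trans ((congrArg (· ≫ (β_ _ _).hom) hk').trans ?_)⟩
    exact BraidedCategory.braiding_naturality _ _
  | @comp u v a b c f g hf hg ihf ihg =>
    -- A composite needs a family at the labels in the middle. Distinctness makes `u` injective on
    -- the labels of `a`, so `φ` can be transported along its inverse; the first morphism is then
    -- treated over `id` and the second over `w`.
    have hb : b.labels.Nodup := by
      rw [hg.labels_perm.nodup_iff] at he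
      exact he.of_map
    have ha : Set.InjOn u {i | i ∈ a.labels} :=
      List.inj_on_of_nodup_map (hf.labels_perm.nodup_iff.mp hb)
    have hmem : ∀ p ∈ a.leaves, p.1 ∈ a.labels := fun p hp => by
      rw [Formal.labels_eq]; exact List.mem_map_of_mem hp
    have hinv : ∀ p ∈ a.leaves, Function.invFunOn u {i | i ∈ a.labels} (u p.1) = p.1 :=
      fun p hp => ha.leftInvOn_invFunOn (hmem p hp)
    obtain ⟨k, hk, hk'⟩ := ihf hb (w := id) (φ := φ)
      (ψ := fun j => φ (Function.invFunOn u {i | i ∈ a.labels} j)) fun p hp => by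
        rw [hinv p hp]; exact Target.Compat.refl _
    obtain ⟨l, hl, hl'⟩ := ihg he (w := w)
      (φ := fun j => φ (Function.invFunOn u {i | i ∈ a.labels} j)) (ψ := ψ) fun p hp => by
        obtain ⟨q, hq, rfl⟩ := List.mem_map.mp (hf.leaves_perm.mem_iff.mp hp)
        simp only [Prod.map_fst, Prod.map_snd, id]
        rw [hinv q hq]
        exact hφ q hq
    refine ⟨k ≫ l, hk.id_comp hl, ?_⟩
    rw [reassoc_of% hk', hl', Category.assoc]
  | @congr u v a b f h hf ih =>
    refine ih he fun p hp => ?_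
    rw [h p.1 (by rw [Formal.labels_eq]; exact List.mem_map_of_mem hp)]
    exact hφ p hp

end Substitution

/-! ### Targets that describe the factors of a constant sequence. -/

section ConstantFamilies

variable {D : Type u} [Category.{v} D] [MonoidalCategory D]

namespace Target

/-- Precomposition of a target with a morphism. -/
def precomp {x y : D} (f : x ⟶ y) (t : Target y) : Target x := ⟨t.form, f ≫ t.hom⟩

/-- The tensor product of targets. -/
def tensor {x y : D} (s : Target x) (t : Target y) : Target (x ⊗ y) :=
  ⟨s.form.tensor t.form, s.hom ⊗ₘ t.hom⟩

open Classical in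
/-- The formal tensor product with the single factor `y`, or with no factor if `y` is the unit. -/
noncomputable def reduced (i : Omega) (y : D) : Target y :=
  if h : y = 𝟙_ D then ⟨.unit, eqToHom h⟩ else ⟨.leaf i y, 𝟙 y⟩

theorem reduced_unit (i : Omega) {y : D} (h : y = 𝟙_ D) :
    reduced i y = ⟨.unit, eqToHom h⟩ := dif_pos h

theorem reduced_of_ne (i : Omega) {y : D} (h : y ≠ 𝟙_ D) :
    reduced i y = ⟨.leaf i y, 𝟙 y⟩ := dif_neg h

theorem isIso_reduced (i : Omega) (y : D) : IsIso (reduced i y).hom := by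
  by_cases h : y = 𝟙_ D
  · rw [reduced_unit i h]; exact inferInstanceAs (IsIso (eqToHom h))
  · rw [reduced_of_ne i h]; exact inferInstanceAs (IsIso (𝟙 y))

open Classical in
/-- Extension of a family of targets of a single object to a family of targets of all objects. -/
noncomputable def extend {x : D} (B : Omega → Target x) (i : Omega) (z : D) : Target z :=
  if h : z = x then precomp (eqToHom h) (B i) else ⟨.leaf i z, 𝟙 z⟩

theorem extend_self {x : D} (B : Omega → Target x) (i : Omega) : extend B i x = B i := by
  simp [extend, precomp]

variable [SymmetricCategory D]

theorem Compat.precomp {x y : D} {w : Omega → Omega} {s t : Target y} (h : s.Compat w t)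
    (f : x ⟶ y) : (s.precomp f).Compat w (t.precomp f) := by
  obtain ⟨k, hk, hk'⟩ := h
  exact ⟨k, hk, (Category.assoc _ _ _).trans (congrArg (f ≫ ·) hk')⟩

theorem Compat.tensor {x y : D} {w : Omega → Omega} {s t : Target x} {s' t' : Target y}
    (h : s.Compat w t) (h' : s'.Compat w t') : (s.tensor s').Compat w (t.tensor t') := by
  obtain ⟨k, hk, hk'⟩ := h
  obtain ⟨l, hl, hl'⟩ := h'
  refine ⟨k ⊗ₘ l, Coh.tensor hk hl, ?_⟩
  change (s.hom ⊗ₘ s'.hom) ≫ (k ⊗ₘ l) = t.hom ⊗ₘ t'.hom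
  rw [tensorHom_comp_tensorHom, hk', hl']

/-- Whether the factor is dropped depends on `y` alone, so relabelling never changes the shape of
the target. -/
theorem compat_reduced (w : Omega → Omega) (i : Omega) (y : D) :
    (reduced i y).Compat w (reduced (w i) y) := by
  by_cases h : y = 𝟙_ D
  · rw [reduced_unit i h, reduced_unit _ h]
    exact ⟨𝟙 _, Coh.unit w, Category.comp_id _⟩
  · rw [reduced_of_ne i h, reduced_of_ne _ h]
    exact ⟨𝟙 _, Coh.leaf w i y, Category.comp_id _⟩

end Target

/-- The formal tensor product of copies of `x` with the given labels. -/
def Formal.const (x : D) (l : List Omega) : Formal D := Formal.ofList (l.map fun i => (i, x))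

theorem Formal.leaves_const (x : D) (l : List Omega) :
    (Formal.const x l).leaves = l.map fun i => (i, x) := Formal.leaves_ofList _

theorem Formal.labels_const (x : D) (l : List Omega) : (Formal.const x l).labels = l := by
  rw [Formal.labels_eq, Formal.leaves_const, List.map_map]
  exact List.map_id _

/-- `Seq.list` omits unit entries exactly as `Target.reduced` does, so both sides are empty when `y`
is the unit. The `flatMap` is the form in which `Formal.leaves_subst` delivers the factors. -/
theorem Seq.leaves_constSeq (y : D) {S S' : Set Omega} (hS : S.Finite) (hS' : S'.Finite)
    {t : Omega → Omega} (ht : Set.BijOn t S S') :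
    (constSeq y S' hS').formal.leaves.Perm ((hS.toFinset.sort (· ≤ ·)).flatMap fun i =>
      (Target.reduced (t i) y).form.leaves) := by
  classical
  rw [Formal.leaves_ofList]
  by_cases h : y = 𝟙_ D
  · have h1 : (constSeq y S' hS').list = [] := List.eq_nil_iff_forall_not_mem.mpr fun p hp => by
      rw [Seq.mem_list] at hp
      exact hp.2 (hp.1.trans (ite_eq_right_iff.mpr fun _ => h))
    rw [h1]
    simp [Target.reduced_unit _ h, Formal.leaves]
  · simp only [Target.reduced_of_ne _ h, Formal.leaves]
    rw [← List.map_eq_flatMap, List.perm_ext_iff_of_nodup (Seq.nodup_list _)]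
    · rintro ⟨i, x⟩
      rw [Seq.mem_list]
      simp only [List.mem_map, Finset.mem_sort, Set.Finite.mem_toFinset, Prod.mk.injEq]
      by_cases hi : i ∈ S'
      · have e : (constSeq y S' hS').obj i = y := if_pos hi
        rw [e]
        obtain ⟨j, hj, rfl⟩ := ht.surjOn hi
        constructor
        · rintro ⟨rfl, -⟩; exact ⟨j, hj, rfl, rfl⟩
        · rintro ⟨-, -, -, rfl⟩; exact ⟨rfl, h⟩
      · have e : (constSeq y S' hS').obj i = 𝟙_ D := if_neg hi
        rw [e]
        constructor
        · rintro ⟨h1, h2⟩; exact absurd h1 h2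
        · rintro ⟨j, hj, rfl, -⟩; exact absurd (ht.mapsTo hj) hi
    · refine List.Nodup.map_on ?_ (Finset.sort_nodup _ _)
      intro i hi j hj hij
      exact ht.injOn (by simpa using hi) (by simpa using hj) (Prod.ext_iff.mp hij).1

end ConstantFamilies

/-! ### Equivariant morphisms from formal products to fixed sequences. -/

section Equivariance

open EMCat

variable {D : Type u} [Category.{v} D] [MonoidalCategory D] [SymmetricCategory D]
  {G : Subgroup Mˣ}

namespace Fixed

/-- The automorphism by which a group element acts on the tensor product of a fixed sequence. -/
noncomputable def rot (Z : Fixed G (Seq D)) {g : Mˣ} (hg : g ∈ G) :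
    Z.obj.tensorAll ⟶ Z.obj.tensorAll :=
  ((EMCat.circ (g : M) Z.obj).hom ≫ eqToHom (Z.smul_eq g hg)).val

theorem coh_rot (Z : Fixed G (Seq D)) {g : Mˣ} (hg : g ∈ G) :
    Coh (fun i => (g : M) • i) Z.obj.formal Z.obj.formal (Z.rot hg) :=
  (Seq.coh_circ _ _).comp_id (Seq.coh_eqToHom _)

/-- A morphism from a formal tensor product to the tensor product of a fixed sequence that commutes
with the permutation of the factors by the group. -/
def IsEquivariant {e : Formal D} {Z : Fixed G (Seq D)} (h : e.eval ⟶ Z.obj.tensorAll) : Prop :=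
  ∀ (g : Mˣ) (hg : g ∈ G), ∃ k : e.eval ⟶ e.eval,
    Coh (fun i => (g : M) • i) e e k ∧ k ≫ h = h ≫ Z.rot hg

/-- A morphism between fixed sequences is fixed when it intertwines the automorphisms `rot`. The
composite `inv h ≫ h'` does so because both intertwine them with the same permutation of the factors
of `e`. -/
theorem IsEquivariant.nonempty_hom {e : Formal D} (he : e.labels.Nodup) {Z Z' : Fixed G (Seq D)}
    {h : e.eval ⟶ Z.obj.tensorAll} {h' : e.eval ⟶ Z'.obj.tensorAll} (hh : IsEquivariant h)
    (hh' : IsEquivariant h') [IsIso h] : Nonempty (Z ⟶ Z') := by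
  refine ⟨⟨⟨inv h ≫ h'⟩, (isFixedHom_iff _).mpr fun g hg => Seq.hom_ext ?_⟩⟩
  obtain ⟨k, hk, e1⟩ := hh g hg
  obtain ⟨k', hk', e2⟩ := hh' g hg
  -- Each hypothesis supplies its own coherence morphism over `g`; they agree since the labels of
  -- `e` are distinct.
  obtain rfl := hk.unique hk' he
  have key : (inv h ≫ h') ≫ Z'.rot hg = Z.rot hg ≫ (inv h ≫ h') := by
    rw [Category.assoc, ← e2, IsIso.inv_comp_eq, reassoc_of% (e1.symm)]
    simp
  refine key.trans ?_
  exact Category.assoc _ _ _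

/-- If the labelled factors are permuted by `G` and the substituted family is compatible with this,
then `Coh.subst` carries the permutation of `e` to one of the substituted product, and uniqueness of
coherence identifies the latter with `rot`. -/
theorem isEquivariant_subst {e : Formal D} (φ : Omega → (x : D) → Target x)
    {Z : Fixed G (Seq D)} (hp : Z.obj.formal.leaves.Perm
      ((e.subst φ).form.leaves.map (Prod.map id id))) (he : e.labels.Nodup)
    (hs : ∀ g ∈ G, e.leaves.Perm (e.leaves.map (Prod.map (fun i => (g : M) • i) id)))
    (hc : ∀ g ∈ G, ∀ p ∈ e.leaves,
      (φ p.1 p.2).Compat (fun i => (g : M) • i) (φ ((g : M) • p.1) p.2)) :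
    IsEquivariant ((e.subst φ).hom ≫ (cohIso hp).hom) := by
  intro g hg
  obtain ⟨k, hk, hk'⟩ := (coh_cohIso (hs g hg)).subst he (hc g hg)
  refine ⟨(cohIso (hs g hg)).hom, coh_cohIso _, ?_⟩
  rw [← reassoc_of% hk', Category.assoc]
  congr 1
  exact (hk.comp_id (coh_cohIso hp)).unique ((coh_cohIso hp).id_comp (Z.coh_rot hg))
    (Seq.nodup_labels _)

/-- The substitution principle for `x^{⊗S}`: the copy of `x` at `i` is replaced by `B i`. Suitable
choices of `B` give all morphisms needed between constant sequences. -/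
theorem exists_isEquivariant {x : D} (S : SubMulAction G Omega) (hS : (S : Set Omega).Finite)
    (B : Omega → Target x) (Z : Fixed G (Seq D)) (hp : Z.obj.formal.leaves.Perm
      ((hS.toFinset.sort (· ≤ ·)).flatMap fun i => (B i).form.leaves))
    (hc : ∀ g ∈ G, ∀ i ∈ S, (B i).Compat (fun i => (g : M) • i) (B ((g : M) • i))) :
    ∃ h : (Formal.const x (hS.toFinset.sort (· ≤ ·))).eval ⟶ Z.obj.tensorAll,
      IsEquivariant h ∧ ((∀ i, IsIso (B i).hom) → IsIso h) := by
  have hm (p : Omega × D) (h : p ∈ (Formal.const x (hS.toFinset.sort (· ≤ ·))).leaves) :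
      p.1 ∈ S ∧ p.2 = x := by
    rw [Formal.leaves_const] at h
    obtain ⟨i, hi, rfl⟩ := List.mem_map.mp h
    exact ⟨by simpa using hi, rfl⟩
  have hp' : Z.obj.formal.leaves.Perm (((Formal.const x (hS.toFinset.sort (· ≤ ·))).subst
      (Target.extend B)).form.leaves.map (Prod.map id id)) := by
    rw [Prod.map_id, List.map_id, Formal.leaves_subst, Formal.leaves_const, List.flatMap_map]
    simpa only [Target.extend_self] using hp
  refine ⟨_, isEquivariant_subst (Target.extend B) hp' ?_ ?_ ?_, fun hB => ?_⟩
  · rw [Formal.labels_const]; exact Finset.sort_nodup _ _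
  · intro g hg
    rw [Formal.leaves_const, List.map_map]
    have e : (Prod.map (fun i : Omega => (g : M) • i) id ∘ fun i : Omega => (i, x)) =
        (fun i : Omega => (i, x)) ∘ fun i => (g : M) • i := rfl
    rw [e, ← List.map_map]
    refine List.Perm.map _ ?_
    rw [List.perm_ext_iff_of_nodup (Finset.sort_nodup _ _)
      ((Finset.sort_nodup _ _).map (M.injective _))]
    intro i
    simp only [List.mem_map, Finset.mem_sort, Set.Finite.mem_toFinset, SetLike.mem_coe]
    constructor
    · intro hi
      exact ⟨((g⁻¹ : Mˣ) : M) • i, S.smul_mem (⟨g, hg⟩⁻¹ : G) hi, by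
        rw [← mul_smul, Units.mul_inv, one_smul]⟩
    · rintro ⟨j, hj, rfl⟩
      exact S.smul_mem (⟨g, hg⟩ : G) hj
  · intro g hg p h
    obtain ⟨h1, h2⟩ := hm p h
    obtain ⟨i, y⟩ := p
    obtain rfl : y = x := h2
    simp only [Target.extend_self]
    exact hc g hg i h1
  · have : IsIso ((Formal.const x (hS.toFinset.sort (· ≤ ·))).subst (Target.extend B)).hom := by
      refine Formal.isIso_subst _ fun p h => ?_
      obtain ⟨h1, h2⟩ := hm p h
      obtain ⟨i, y⟩ := p
      obtain rfl : y = x := h2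
      change IsIso (Target.extend B i y).hom
      rw [Target.extend_self]
      exact hB i
    infer_instance

end Fixed

end Equivariance

open EMCat

/-! ### Fixed morphisms between constant sequences. -/

section FixedConst

variable {D : PermCat.{u}} {G : UniversalSubgroup}

/-- A morphism of `D` and an isomorphism of `G`-sets induce a morphism of constant sequences. -/
theorem nonempty_hom_fixedConstSeq {S S' : SubMulAction G.group Omega}
    (hS : (S : Set Omega).Finite) (hS' : (S' : Set Omega).Finite) {t : Omega → Omega}
    (ht : Set.BijOn t S S') (htg : ∀ g ∈ G.group, ∀ i ∈ S, t ((g : M) • i) = (g : M) • t i)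
    {X Y : D.carrier} (f : X ⟶ Y) :
    Nonempty (fixedConstSeq X S hS ⟶ fixedConstSeq Y S' hS') := by
  let Z : Fixed G.group (Seq D.carrier) := fixedConstSeq X S hS
  let Z' : Fixed G.group (Seq D.carrier) := fixedConstSeq Y S' hS'
  obtain ⟨h, hh, hi⟩ := Fixed.exists_isEquivariant S hS (fun i => Target.reduced i X) Z
    (Seq.leaves_constSeq X hS hS (Set.bijOn_id _))
    (fun g hg i hi => Target.compat_reduced (fun i => (g : M) • i) i X)
  -- The copy of `X` at `i` is sent by `f` to the factor `Y` at `t i`, so `h'` is `f^{⊗S}` up to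
  -- reindexing. Only `h` has to be invertible.
  obtain ⟨h', hh', -⟩ := Fixed.exists_isEquivariant S hS
    (fun i => (Target.reduced (t i) Y).precomp f) Z' (Seq.leaves_constSeq Y hS hS' ht)
    (fun g hg i hi => by
      rw [htg g hg i hi]
      exact (Target.compat_reduced (fun i => (g : M) • i) (t i) Y).precomp f)
  have := hi fun i => Target.isIso_reduced i X
  exact hh.nonempty_hom (by rw [Formal.labels_const]; exact Finset.sort_nodup _ _) hh'

theorem supp_constSeq_subset (X : D.carrier) (S : Set Omega) (hS : S.Finite) :
    supp (constSeq X S hS) ⊆ S := by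
  rw [Seq.supp_eq]
  intro i hi
  by_contra h
  exact hi (if_neg h)

theorem disjoint_supp_fixedConstSeq {S S' : SubMulAction G.group Omega}
    (hS : (S : Set Omega).Finite) (hS' : (S' : Set Omega).Finite)
    (h : Disjoint (S : Set Omega) (S' : Set Omega)) (X Y : D.carrier) :
    Disjoint (supp (fixedConstSeq X S hS).obj) (supp (fixedConstSeq Y S' hS').obj) :=
  h.mono (supp_constSeq_subset X S hS) (supp_constSeq_subset Y S' hS')

/-- The copy of `X ⊗ Y` at `i` is split into `X` at `i` and `Y` at `t i`. This gives additivity of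
`[X] ↦ [Π(X, S)]`; the second summand sits on a disjoint copy of `S` because the sum is only
partially defined. -/
theorem nonempty_hom_fixedConstSeq_tensor {S S' : SubMulAction G.group Omega}
    (hS : (S : Set Omega).Finite) (hS' : (S' : Set Omega).Finite)
    (hd : Disjoint (S : Set Omega) (S' : Set Omega)) {t : Omega → Omega}
    (ht : Set.BijOn t S S') (htg : ∀ g ∈ G.group, ∀ i ∈ S, t ((g : M) • i) = (g : M) • t i)
    (X Y : D.carrier) :
    Nonempty (fixedConstSeq (X ⊗ Y) S hS ⟶ Fixed.add (fixedConstSeq X S hS)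
      (fixedConstSeq Y S' hS') (disjoint_supp_fixedConstSeq hS hS' hd X Y)) := by
  let Z : Fixed G.group (Seq D.carrier) := fixedConstSeq (X ⊗ Y) S hS
  let Z' : Fixed G.group (Seq D.carrier) := Fixed.add (fixedConstSeq X S hS)
      (fixedConstSeq Y S' hS') (disjoint_supp_fixedConstSeq hS hS' hd X Y)
  obtain ⟨h, hh, hi⟩ := Fixed.exists_isEquivariant S hS (fun i => Target.reduced i (X ⊗ Y)) Z
    (Seq.leaves_constSeq (X ⊗ Y) hS hS (Set.bijOn_id _))
    (fun g hg i hi => Target.compat_reduced (fun i => (g : M) • i) i (X ⊗ Y))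
  have hp : Z'.obj.formal.leaves.Perm ((hS.toFinset.sort (· ≤ ·)).flatMap fun i =>
      ((Target.reduced i X).tensor (Target.reduced (t i) Y)).form.leaves) := by
    have h1 := Seq.leaves_add (X := constSeq X S hS) (Y := constSeq Y S' hS')
      (disjoint_supp_fixedConstSeq hS hS' hd X Y)
    rw [Prod.map_id, List.map_id] at h1
    refine h1.symm.trans ?_
    exact ((Seq.leaves_constSeq X hS hS (Set.bijOn_id _)).append
      (Seq.leaves_constSeq Y hS hS' ht)).trans (List.flatMap_append_perm _ _ _)
  obtain ⟨h', hh', -⟩ := Fixed.exists_isEquivariant S hS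
    (fun i => (Target.reduced i X).tensor (Target.reduced (t i) Y)) Z' hp
    (fun g hg i hi => by
      rw [htg g hg i hi]
      exact (Target.compat_reduced (fun i => (g : M) • i) i X).tensor
        (Target.compat_reduced (fun i => (g : M) • i) (t i) Y))
  have := hi fun i => Target.isIso_reduced i (X ⊗ Y)
  exact hh.nonempty_hom (by rw [Formal.labels_const]; exact Finset.sort_nodup _ _) hh'

end FixedConst

/-! ### Elementary facts on path components. -/

/-- A function that identifies the source and the target of every morphism is constant on path
components. -/
theorem eq_of_zigzag {C : Type*} [Category C] {α : Sort*} (F : C → α)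
    (h : ∀ {X Y : C}, (X ⟶ Y) → F X = F Y) {X Y : C} (z : Zigzag X Y) : F X = F Y := by
  induction z with
  | refl => rfl
  | tail _ z ih =>
    rcases z with ⟨⟨f⟩⟩ | ⟨⟨f⟩⟩
    · exact ih.trans (h f)
    · exact ih.trans (h f).symm

theorem Fixed.ext' {C : Type u} [Category.{v} C] [EMCat C] {G : Subgroup Mˣ} {X Y : Fixed G C}
    (h : X.obj = Y.obj) : X = Y := by
  cases X; cases Y; cases h; rfl

namespace ParSumCat.FixedPi0

variable {C : ParSumCat.{u}} {G : UniversalSubgroup}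

theorem mk_eq_of_hom {X Y : Fixed G.group C.carrier} (f : X ⟶ Y) :
    (FixedPi0.mk X : C.FixedPi0 G) = FixedPi0.mk Y := Quotient.sound (Zigzag.of_hom f)

theorem mk_eq_zero {X : Fixed G.group C.carrier} (h : X.obj = Parsummable.zero) :
    (FixedPi0.mk X : C.FixedPi0 G) = 0 := by
  obtain rfl : X = ⟨Parsummable.zero, fun g _ => Parsummable.smul_zero _⟩ := Fixed.ext' h
  rfl

end ParSumCat.FixedPi0

open ParSumCat

/-! ### The homomorphism attached to a finite `G`-subset of `ω`, and its dependence on that subset.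
-/

section Comparison

variable (D : PermCat.{u}) {G : UniversalSubgroup}

/-- Every finite `G`-subset of `ω` has an isomorphic copy disjoint from it. -/
theorem UniversalSubgroup.exists_disjoint (S : SubMulAction G.group Omega)
    (hS : (S : Set Omega).Finite) :
    ∃ (S' : SubMulAction G.group Omega) (_ : (S' : Set Omega).Finite) (t : Omega → Omega),
      Disjoint (S : Set Omega) (S' : Set Omega) ∧ Set.BijOn t S S' ∧
        ∀ g ∈ G.group, ∀ i ∈ S, t ((g : M) • i) = (g : M) • t i := by
  obtain ⟨w, hw, hwS⟩ := G.exists_move S S hS hS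
  have hwg (g : G.group) (i : Omega) : w • g • i = g • w • i := by
    have := congrArg (· • i) (hw g g.2)
    simp only [mul_smul] at this
    exact this.symm
  refine ⟨⟨(fun i => w • i) '' S, ?_⟩, hS.image _, fun i => w • i, ?_, ?_, ?_⟩
  · rintro g _ ⟨i, hi, rfl⟩
    exact ⟨g • i, S.smul_mem g hi, hwg g i⟩
  · rw [Set.disjoint_left]
    rintro _ hi ⟨j, hj, rfl⟩
    exact hwS j hj hi
  · exact (w.injective.injOn).bijOn_image
  · exact fun g hg i _ => hwg ⟨g, hg⟩ i

/-- The homomorphism that sends `[X]` to the class of the constant sequence `Π(X, S)`. -/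
noncomputable def constHom (S : SubMulAction G.group Omega) (hS : (S : Set Omega).Finite) :
    D.Pi0 →+ (Phi D).FixedPi0 G where
  toFun := Quotient.lift (fun X => FixedPi0.mk (fixedConstSeq X S hS)) fun X Y z =>
    eq_of_zigzag _ (fun f => FixedPi0.mk_eq_of_hom (nonempty_hom_fixedConstSeq hS hS
      (t := id) (Set.bijOn_id _) (fun _ _ _ _ => rfl) f).some) z
  map_zero' := FixedPi0.mk_eq_zero (Seq.ext (funext fun i => ite_self _))
  map_add' x y := by
    obtain ⟨X, rfl⟩ := Quotient.exists_rep x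
    obtain ⟨Y, rfl⟩ := Quotient.exists_rep y
    -- In `π₀` the summand for `Y` may be moved to a disjoint copy of `S`, where the sum of
    -- representatives is defined and receives a morphism from `Π(X ⊗ Y, S)`.
    obtain ⟨S', hS', t, hd, ht, htg⟩ := UniversalSubgroup.exists_disjoint S hS
    have e1 : (FixedPi0.mk (fixedConstSeq Y S hS) : (Phi D).FixedPi0 G) =
        FixedPi0.mk (fixedConstSeq Y S' hS') := FixedPi0.mk_eq_of_hom
      (nonempty_hom_fixedConstSeq hS hS' ht htg (𝟙 Y)).some
    have e2 := FixedPi0.mk_add_mk (Phi D) G (fixedConstSeq X S hS) (fixedConstSeq Y S' hS')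
      (disjoint_supp_fixedConstSeq hS hS' hd X Y)
    have e3 := FixedPi0.mk_eq_of_hom
      (nonempty_hom_fixedConstSeq_tensor (D := D) hS hS' hd ht htg X Y).some
    refine Eq.trans e3 (e2.symm.trans ?_)
    rw [← e1]
    rfl

variable {D}

theorem constHom_mk (S : SubMulAction G.group Omega) (hS : (S : Set Omega).Finite)
    (X : D.carrier) : constHom D S hS (PermCat.Pi0.mk X) = FixedPi0.mk (fixedConstSeq X S hS) :=
  rfl

/-- This is why `a_G` does not depend on the subset chosen to represent a transitive `G`-set. -/
theorem mk_fixedConstSeq_congr {S S' : SubMulAction G.group Omega} (hS : (S : Set Omega).Finite)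
    (hS' : (S' : Set Omega).Finite) (e : S ≃ S')
    (he : ∀ (g : G.group) (s : S), e (g • s) = g • e s) (X : D.carrier) :
    (FixedPi0.mk (fixedConstSeq X S hS) : (Phi D).FixedPi0 G) =
      FixedPi0.mk (fixedConstSeq X S' hS') := by
  classical
  -- The value outside `S` is arbitrary; all conditions on `t` concern points of `S`.
  let t : Omega → Omega := fun i => if h : i ∈ S then e ⟨i, h⟩ else i
  have ht (s : S) : t s = e s := dif_pos s.2
  refine FixedPi0.mk_eq_of_hom (nonempty_hom_fixedConstSeq hS hS' (t := t) ⟨?_, ?_, ?_⟩ ?_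
    (𝟙 X)).some
  · intro i hi
    rw [ht ⟨i, hi⟩]
    exact (e ⟨i, hi⟩).2
  · intro i hi j hj hij
    rw [ht ⟨i, hi⟩, ht ⟨j, hj⟩] at hij
    exact congrArg Subtype.val (e.injective (Subtype.ext hij))
  · intro j hj
    exact ⟨e.symm ⟨j, hj⟩, (e.symm ⟨j, hj⟩).2, by rw [ht, Equiv.apply_symm_apply]⟩
  · intro g hg i hi
    have h1 := ht ((⟨g, hg⟩ : G.group) • (⟨i, hi⟩ : S))
    rw [he] at h1
    have h2 := ht ⟨i, hi⟩
    rw [h2]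
    exact h1

/-- Universality applies to `T`, which is finite because the finite group `G` surjects onto it. -/
theorem UniversalSubgroup.exists_subset (T : TransitiveSet G) :
    ∃ S : SubMulAction G.group Omega, (S : Set Omega).Finite ∧
      ∃ e : S ≃ T.carrier, ∀ (g : G.group) (s : S), e (g • s) = g • e s := by
  have := G.finite
  have : Finite T.carrier :=
    Finite.of_surjective _ (MulAction.surjective_smul G.group (Classical.arbitrary T.carrier))
  obtain ⟨f, hf, hfg⟩ := G.universal T.carrier
  let S : SubMulAction G.group Omega := ⟨Set.range f, by
    rintro g _ ⟨a, rfl⟩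
    exact ⟨g • a, hfg g a⟩⟩
  let e : T.carrier ≃ S := Equiv.ofInjective f hf
  refine ⟨S, Set.finite_range f, e.symm, fun g s => ?_⟩
  rw [Equiv.symm_apply_eq]
  refine Subtype.ext ((congrArg (fun s : S => g • (s : Omega)) (e.apply_symm_apply s)).symm.trans ?_)
  exact (hfg g _).symm

/-- By orbit and stabilizer, subgroups exhaust the classes. Hence there are finitely many classes,
and at most two if `G` has prime order. -/
theorem TransitiveClass.exists_quotient (c : TransitiveClass G) :
    ∃ H : Subgroup G.group, Quotient.mk _ (⟨G.group ⧸ H⟩ : TransitiveSet G) = c := by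
  obtain ⟨T, rfl⟩ := Quotient.exists_rep c
  let t : T.carrier := Classical.arbitrary T.carrier
  refine ⟨MulAction.stabilizer G.group t, Quotient.sound ⟨Equiv.ofBijective
    (MulAction.ofQuotientStabilizer G.group t)
    ⟨MulAction.injective_ofQuotientStabilizer G.group t, fun s => ?_⟩,
    MulAction.ofQuotientStabilizer_smul G.group t⟩⟩
  obtain ⟨g, hg⟩ := MulAction.exists_smul_eq G.group t s
  exact ⟨g, hg⟩

/-- Over a finite index set the product is also a direct sum, so homomorphisms out of it can be
defined and compared one factor at a time. -/
instance : Finite (TransitiveClass G) := by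
  have := G.finite
  exact Finite.of_surjective _ TransitiveClass.exists_quotient

end Comparison

/-! ### Existence, uniqueness and surjectivity of `a_G`, and injectivity for the trivial group. -/

section Existence

variable (D : PermCat.{u}) (G : UniversalSubgroup)

/-- Choose one subset of `ω` for each class and add up the homomorphisms `constHom`; on a single
factor only one term survives. -/
theorem exists_isComparison :
    ∃ a : (TransitiveClass G → D.Pi0) →+ (Phi D).FixedPi0 G, IsComparison a := by
  classical
  have := Fintype.ofFinite (TransitiveClass G)
  choose S hS e he using fun c : TransitiveClass G => G.exists_subset c.out
  refine ⟨∑ c, (constHom D (S c) (hS c)).comp (Pi.evalAddMonoidHom _ c), ?_⟩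
  intro T S' hS' e' he' X
  -- The subset was chosen for the representative `out` of the class of `T`; `k` compares this
  -- representative with `T` itself.
  obtain ⟨k, hk⟩ := Quotient.exact (Quotient.out_eq (Quotient.mk (TransitiveSet.setoid G) T))
  rw [AddMonoidHom.finsetSum_apply, Finset.sum_eq_single (Quotient.mk _ T)]
  · rw [AddMonoidHom.comp_apply, Pi.evalAddMonoidHom_apply, Pi.single_eq_same, constHom_mk]
    refine mk_fixedConstSeq_congr _ hS' (((e _).trans k).trans e'.symm) (fun g s => ?_) X
    simp only [Equiv.trans_apply]
    rw [Equiv.symm_apply_eq, he', Equiv.apply_symm_apply, he, hk]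
  · intro c _ hc
    rw [AddMonoidHom.comp_apply, Pi.evalAddMonoidHom_apply, Pi.single_eq_of_ne hc, map_zero]
  · exact fun h => absurd (Finset.mem_univ _) h

variable {D G}

/-- A homomorphism on a finite product is determined on the factors, and every transitive `G`-set
occurs in `ω`, so the defining property prescribes all values there. -/
theorem IsComparison.unique {a b : (TransitiveClass G → D.Pi0) →+ (Phi D).FixedPi0 G}
    (ha : IsComparison a) (hb : IsComparison b) : a = b := by
  classical
  refine AddMonoidHom.functions_ext _ _ _ fun c x => ?_
  obtain ⟨T, rfl⟩ := Quotient.exists_rep c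
  obtain ⟨X, rfl⟩ := Quotient.exists_rep x
  obtain ⟨S, hS, e, he⟩ := G.exists_subset T
  have h1 := ha T S hS e he X
  have h2 := hb T S hS e he X
  change a (Pi.single _ (PermCat.Pi0.mk X)) = b (Pi.single _ (PermCat.Pi0.mk X))
  convert h1.trans h2.symm

/-- The sequence that agrees with `Z` outside a `G`-subset and is the unit on it. -/
noncomputable def Fixed.erase (Z : Fixed G.group (Seq D.carrier)) (S : SubMulAction G.group Omega) :
    Fixed G.group (Seq D.carrier) where
  obj :=
    { obj := open Classical in fun i => if i ∈ S then 𝟙_ D.carrier else Z.obj.obj i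
      finite := Z.obj.finite.subset fun i hi h => by
        refine hi ?_
        by_cases hS : i ∈ S
        · exact if_pos hS
        · exact (if_neg hS).trans h }
  smul_eq g hg := by
    refine Seq.ext (funext fun i => ?_)
    obtain ⟨j, rfl⟩ : ∃ j : Omega, (g : M) • j = i :=
      ⟨((g⁻¹ : Mˣ) : M) • i, by rw [← mul_smul, Units.mul_inv, one_smul]⟩
    rw [Seq.smul_obj_smul]
    have h : j ∈ S ↔ (g : M) • j ∈ S := (S.smul_mem_iff' (⟨g, hg⟩ : G.group)).symm
    have h' := Seq.smul_obj_smul (g : M) Z.obj j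
    rw [Z.smul_eq g hg] at h'
    classical exact if_congr h rfl h'.symm

/-- Constancy along orbits is what allows an orbit to be split off as some `Π(X, S)`. -/
theorem Fixed.obj_smul (Z : Fixed G.group (Seq D.carrier)) (g : G.group) (i : Omega) :
    Z.obj.obj (g • i) = Z.obj.obj i := by
  have h' := Seq.smul_obj_smul ((g : Mˣ) : M) Z.obj i
  rw [Z.smul_eq g g.2] at h'
  exact h'

/-- The orbit of a point of `ω`. -/
def orbitSub (G : UniversalSubgroup) (i : Omega) : SubMulAction G.group Omega where
  carrier := MulAction.orbit G.group i
  smul_mem' g _ h := MulAction.mem_orbit_of_mem_orbit g h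

theorem finite_orbitSub (i : Omega) : (orbitSub G i : Set Omega).Finite := by
  have := G.finite
  exact Set.finite_range _

/-- The orbit of a point of `ω` as a transitive `G`-set. -/
def orbitSet (G : UniversalSubgroup) (i : Omega) : TransitiveSet G where
  carrier := orbitSub G i
  transitive := inferInstanceAs (MulAction.IsPretransitive G.group (MulAction.orbit G.group i))
  nonempty := ⟨⟨i, MulAction.mem_orbit_self i⟩⟩

/-- Induction on the number of entries different from the unit: the orbit of such an entry
contributes a sequence `Π(X, S)`, whose class lies in the range, and erasing it leaves a smaller
fixed sequence. A bound `n` is used because a whole orbit disappears at once. -/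
theorem IsComparison.mk_mem_range {a : (TransitiveClass G → D.Pi0) →+ (Phi D).FixedPi0 G}
    (ha : IsComparison a) (n : ℕ) (Z : Fixed G.group (Seq D.carrier))
    (hn : {i | Z.obj.obj i ≠ 𝟙_ D.carrier}.ncard ≤ n) :
    (FixedPi0.mk (C := Phi D) Z) ∈ AddMonoidHom.mrange a := by
  induction n generalizing Z with
  | zero =>
    rw [Nat.le_zero, Set.ncard_eq_zero Z.obj.finite] at hn
    rw [FixedPi0.mk_eq_zero (C := Phi D) (X := Z)]
    · exact zero_mem _
    · refine Seq.ext (funext fun i => ?_)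
      by_contra h
      exact (Set.ext_iff.mp hn i).mp h
  | succ n ih =>
    by_cases hZ : ∃ i, Z.obj.obj i ≠ 𝟙_ D.carrier
    · obtain ⟨i, hi⟩ := hZ
      let S := orbitSub G i
      let A : Fixed G.group (Phi D).carrier := fixedConstSeq (Z.obj.obj i) S (finite_orbitSub i)
      let Z' : Fixed G.group (Phi D).carrier := Z.erase S
      have hin (j : Omega) (hj : j ∈ S) : (Z.erase S).obj.obj j = 𝟙_ D.carrier := if_pos hj
      have hout (j : Omega) (hj : j ∉ S) : (Z.erase S).obj.obj j = Z.obj.obj j := if_neg hj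
      have hd : Disjoint (supp A.obj) (supp Z'.obj) := by
        refine Disjoint.mono_left (supp_constSeq_subset _ (S : Set Omega) (finite_orbitSub i)) ?_
        rw [Set.disjoint_left]
        intro j hj hj'
        have hj'' : j ∈ supp (Z.erase S).obj := hj'
        rw [Seq.supp_eq] at hj''
        exact hj'' (hin j hj)
      have hadd : (Z : Fixed G.group (Phi D).carrier) = Fixed.add A Z' hd := by
        refine Fixed.ext' (Seq.ext (funext fun j => ?_))
        change Z.obj.obj j = (Seq.add (constSeq (Z.obj.obj i) (S : Set Omega) (finite_orbitSub i))
          (Z.erase S).obj).obj j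
        by_cases hj : j ∈ S
        · have e : (constSeq (Z.obj.obj i) (S : Set Omega) (finite_orbitSub i)).obj j =
            Z.obj.obj i := if_pos hj
          rw [Seq.add_obj_left _ (by rwa [e]), e]
          obtain ⟨g, rfl⟩ := hj
          exact Z.obj_smul g i
        · have e : (constSeq (Z.obj.obj i) (S : Set Omega) (finite_orbitSub i)).obj j =
            𝟙_ D.carrier := if_neg hj
          rw [Seq.add_obj_right _ e, hout j hj]
      -- Nothing new appears, and the position `i` is lost.
      have hcard : {j | (Z.erase S).obj.obj j ≠ 𝟙_ D.carrier}.ncard ≤ n := by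
        rw [← Nat.lt_succ_iff]
        refine lt_of_lt_of_le (Set.ncard_lt_ncard ⟨fun j hj => ?_, fun h => ?_⟩ Z.obj.finite) hn
        · intro hj'
          by_cases hjS : j ∈ S
          · exact hj (hin j hjS)
          · exact hj ((hout j hjS).trans hj')
        · exact h hi (hin i (MulAction.mem_orbit_self i))
      rw [hadd, ← FixedPi0.mk_add_mk]
      refine add_mem ⟨_, ha (orbitSet G i) S (finite_orbitSub i) (Equiv.refl _)
        (fun _ _ => rfl) _⟩ (ih _ hcard)
    · push Not at hZ
      refine ih Z ?_
      simp [hZ]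

theorem IsComparison.surjective {a : (TransitiveClass G → D.Pi0) →+ (Phi D).FixedPi0 G}
    (ha : IsComparison a) : Function.Surjective a := by
  intro x
  obtain ⟨Z, rfl⟩ := Quotient.exists_rep x
  exact ha.mk_mem_range _ Z le_rfl

/-- The class of the tensor product of all entries. -/
noncomputable def total : (Phi D).Pi0 →+ D.Pi0 where
  toFun := Quotient.lift (fun Z : Seq D.carrier => PermCat.Pi0.mk Z.tensorAll) fun _ _ z =>
    eq_of_zigzag (C := Seq D.carrier) (fun Z => PermCat.Pi0.mk Z.tensorAll)
      (fun f => PermCat.Pi0.mk_eq.mpr (Zigzag.of_hom (Seq.Hom.val f))) z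
  map_zero' := by
    change PermCat.Pi0.mk (Seq.zero : Seq D.carrier).tensorAll = PermCat.Pi0.mk (𝟙_ D.carrier)
    rw [Seq.tensorAll, Seq.formal_zero]
  map_add' x y := by
    obtain ⟨X, rfl, -⟩ := (sumData (Phi D).carrier).exists_rep x ∅ Set.finite_empty
    obtain ⟨Y, rfl, h⟩ := (sumData (Phi D).carrier).exists_rep y _
      ((sumData (Phi D).carrier).finite_sp X)
    refine (congrArg _ (Pi0.mk_add_mk (Phi D) X Y h)).trans ?_
    exact PermCat.Pi0.mk_eq.mpr (Zigzag.of_hom (Seq.split h).hom)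

/-- The case `X = 𝟙` is separate: the list of entries is then empty instead of having one member. -/
theorem nonempty_iso_tensorAll_constSeq (X : D.carrier) (i : Omega) {S : Set Omega} (hS : S.Finite)
    (h : S = {i}) : Nonempty (X ≅ (constSeq X S hS).tensorAll) := by
  subst h
  by_cases hX : X = 𝟙_ D.carrier
  · have : constSeq X {i} hS = Seq.zero := Seq.ext (funext fun j => by
      by_cases hj : j ∈ ({i} : Set Omega)
      · exact (if_pos hj).trans hX
      · exact if_neg hj)
    rw [this, Seq.tensorAll, Seq.formal_zero]
    exact ⟨eqToIso hX⟩
  · have := Seq.leaves_constSeq X hS hS (Set.bijOn_id _)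
    rw [Set.Finite.toFinset_singleton, Finset.sort_singleton, List.flatMap_singleton,
      Target.reduced_of_ne _ hX] at this
    exact ⟨cohIso (u := id) (e := .leaf i X) this⟩

/-- The class of the tensor product of all entries of a fixed sequence. -/
noncomputable def fixedTotal : (Phi D).FixedPi0 G → D.Pi0 :=
  Quotient.lift (fun Z : Fixed G.group (Seq D.carrier) => PermCat.Pi0.mk Z.obj.tensorAll)
    fun _ _ z => eq_of_zigzag (C := Fixed G.group (Seq D.carrier))
      (fun Z => PermCat.Pi0.mk Z.obj.tensorAll)
      (fun f => PermCat.Pi0.mk_eq.mpr (Zigzag.of_hom (Seq.Hom.val (Subtype.val f)))) z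

theorem subsingleton_transitiveClass (hG : G.group = ⊥) : Subsingleton (TransitiveClass G) := by
  have hs : Subsingleton G.group := by rw [hG]; infer_instance
  have hT (T : TransitiveSet G) : Subsingleton T.carrier := ⟨fun s t => by
    obtain ⟨g, rfl⟩ := MulAction.exists_smul_eq G.group s t
    rw [Subsingleton.elim g 1, one_smul]⟩
  refine ⟨fun c c' => ?_⟩
  obtain ⟨T, rfl⟩ := Quotient.exists_rep c
  obtain ⟨T', rfl⟩ := Quotient.exists_rep c'
  have := hT T
  have := hT T'
  exact Quotient.sound ⟨⟨fun _ => Classical.arbitrary _, fun _ => Classical.arbitrary _,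
    fun _ => Subsingleton.elim _ _, fun _ => Subsingleton.elim _ _⟩,
    fun _ _ => Subsingleton.elim _ _⟩

theorem coe_orbitSub_of_eq_bot (hG : G.group = ⊥) (i : Omega) :
    (orbitSub G i : Set Omega) = {i} := by
  have hs : Subsingleton G.group := by rw [hG]; infer_instance
  refine Set.Subset.antisymm ?_ (Set.singleton_subset_iff.mpr (MulAction.mem_orbit_self i))
  rintro _ ⟨g, rfl⟩
  change g • i = i
  rw [Subsingleton.elim g 1, one_smul]

/-- With a single class, represented by the one-point orbit of `1`, `fixedTotal` is a left inverse
of `a`, since the tensor product of the entries of `Π(X, {1})` is isomorphic to `X`. -/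
theorem IsComparison.injective {a : (TransitiveClass G → D.Pi0) →+ (Phi D).FixedPi0 G}
    (ha : IsComparison a) (hG : G.group = ⊥) : Function.Injective a := by
  classical
  have := subsingleton_transitiveClass hG
  let c : TransitiveClass G := Quotient.mk _ (orbitSet G 1)
  have key (f : TransitiveClass G → D.Pi0) : fixedTotal (a f) = f c := by
    obtain ⟨X, hX⟩ := Quotient.exists_rep (f c)
    have hf : f = Pi.single c (PermCat.Pi0.mk X) := by
      funext c'
      rw [Subsingleton.elim c' c, Pi.single_eq_same]
      exact hX.symm
    have h1 : a f = FixedPi0.mk (fixedConstSeq X (orbitSub G 1) (finite_orbitSub 1)) := by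
      rw [← ha (orbitSet G 1) (orbitSub G 1) (finite_orbitSub 1) (Equiv.refl _) (fun _ _ => rfl) X,
        hf]
    rw [h1, ← hX]
    obtain ⟨k⟩ := nonempty_iso_tensorAll_constSeq X 1 (finite_orbitSub 1)
      (coe_orbitSub_of_eq_bot hG 1)
    exact (PermCat.Pi0.mk_eq (D := D)).mpr (Zigzag.of_inv k.hom)
  intro f f' h
  funext c'
  rw [Subsingleton.elim c' c, ← key f, ← key f', h]

end Existence

/-! ### The rank argument against `ℕ` and `ℕ³`. -/

section NoSuchCategory

/-- The class of `X` comes from the sequence with the single entry `X` at position `1`. No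
injectivity of `total` is needed below. -/
theorem surjective_total (D : PermCat.{u}) : Function.Surjective (total (D := D)) := by
  intro x
  obtain ⟨X, rfl⟩ := Quotient.exists_rep x
  obtain ⟨k⟩ := nonempty_iso_tensorAll_constSeq X 1 (Set.finite_singleton 1) rfl
  exact ⟨Pi0.mk (C := Phi D) (constSeq X {1} (Set.finite_singleton 1)),
    PermCat.Pi0.mk_eq.mpr (Zigzag.of_inv k.hom)⟩

/-- A group of prime order has no subgroups besides `⊥` and `⊤`. -/
theorem card_transitiveClass_le {G : UniversalSubgroup} (p : ℕ) [hp : Fact p.Prime]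
    (h : Nat.card G.group = p) : Nat.card (TransitiveClass G) ≤ 2 := by
  have hs : Function.Surjective fun b : Bool => (Quotient.mk _
      (⟨G.group ⧸ (if b then (⊥ : Subgroup G.group) else ⊤)⟩ : TransitiveSet G) :
        TransitiveClass G) := by
    intro c
    obtain ⟨H, rfl⟩ := TransitiveClass.exists_quotient c
    have : Fact (Nat.card G.group).Prime := ⟨h ▸ hp.out⟩
    rcases H.eq_bot_or_eq_top_of_prime_card with rfl | rfl
    · exact ⟨true, rfl⟩
    · exact ⟨false, rfl⟩
  simpa using Nat.card_le_card_of_surjective _ hs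

/-- A quotient of a power `ℕ ^ ι` cannot be `ℕ ^ κ` with `κ` larger than `ι`. -/
theorem card_le_of_surjective {ι κ : Type*} [Finite ι] [Finite κ] (F : (ι → ℕ) →+ (κ → ℕ))
    (hF : Function.Surjective F) : Nat.card κ ≤ Nat.card ι := by
  classical
  have := Fintype.ofFinite ι
  have := Fintype.ofFinite κ
  -- `L` is the rational extension of `F`, determined by the values of `F` on the standard
  -- generators.
  let L : (ι → ℚ) →ₗ[ℚ] (κ → ℚ) :=
    Fintype.linearCombination ℚ fun i k => ((F (Pi.single i 1) k : ℕ) : ℚ)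
  have hL (f : ι → ℕ) : L (fun i => (f i : ℚ)) = fun k => ((F f k : ℕ) : ℚ) := by
    funext k
    have hf : f = ∑ i, f i • Pi.single i (1 : ℕ) := by
      funext j
      simp [Finset.sum_apply, Pi.single_apply]
    conv_rhs => rw [hf]
    simp only [L, Fintype.linearCombination_apply, Finset.sum_apply, map_sum, map_nsmul,
      Pi.smul_apply, smul_eq_mul, Nat.cast_sum, Nat.cast_mul]
  have hs : LinearMap.range L = ⊤ := by
    -- The range of `L` contains the standard basis, because `F` already hits each of its vectors.
    rw [eq_top_iff, ← (Pi.basisFun ℚ κ).span_eq, Submodule.span_le]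
    rintro _ ⟨k, rfl⟩
    obtain ⟨f, hf⟩ := hF (Pi.single k 1)
    refine ⟨_, (hL f).trans ?_⟩
    funext j
    rw [hf]
    simp [Pi.single_apply]
  have := LinearMap.finrank_le_finrank_of_surjective (LinearMap.range_eq_top.mp hs)
  simpa using this

/-- Composing `ℕ ≅ π₀ (Φ D) → π₀ D` in each coordinate with `a_G` would give a surjection onto `ℕ³`
from a power of `ℕ` with at most two factors. -/
theorem not_exists_permCat : ¬ ∃ (D : PermCat.{u}) (G : UniversalSubgroup),
    Nonempty (G.group ≃* Multiplicative (ZMod 3)) ∧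
    Nonempty ((Phi D).Pi0 ≃+ ℕ) ∧
    Nonempty ((Phi D).FixedPi0 G ≃+ (Fin 3 → ℕ)) := by
  rintro ⟨D, G, ⟨e⟩, ⟨e₁⟩, ⟨e₂⟩⟩
  obtain ⟨a, ha⟩ := exists_isComparison D G
  let t : ℕ →+ D.Pi0 := total.comp e₁.symm.toAddMonoidHom
  have ht : Function.Surjective t := (surjective_total D).comp e₁.symm.surjective
  let F : (TransitiveClass G → ℕ) →+ (Fin 3 → ℕ) :=
    e₂.toAddMonoidHom.comp (a.comp (t.compLeft _))
  have hF : Function.Surjective F :=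
    e₂.surjective.comp (ha.surjective.comp (Function.Surjective.comp_left ht))
  have h1 := card_le_of_surjective F hF
  have h2 := card_transitiveClass_le (G := G) 3 (by
    rw [Nat.card_congr e.toEquiv]; exact Nat.card_zmod 3)
  rw [Nat.card_eq_fintype_card (α := Fin 3), Fintype.card_fin] at h1
  omega

end NoSuchCategory

/-! ### Path components of fixed points as invariants of the localization. -/

section Components

open Opposite Simplicial TypeCat

variable {A B : Type u} [SmallCategory A] [SmallCategory B]

/-- All structure maps of a constant simplicial set are identities, so naturality for the inclusion
of a vertex shows that `ψ` takes the same value on a simplex and on each of its vertices. -/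
theorem nerveHom_app (X : Type u) (ψ : nerve A ⟶ (Functor.const _).obj X) {n : SimplexCategoryᵒᵖ}
    (s : ComposableArrows A n.unop.len) (i : Fin (n.unop.len + 1)) :
    ψ.app n s = ψ.app (op ⦋0⦌) (ComposableArrows.mk₀ (s.obj i)) := by
  have h := ConcreteCategory.congr_hom
    (ψ.naturality (SimplexCategory.const ⦋0⦌ n.unop i).op) s
  have e : (nerve A).map (SimplexCategory.const ⦋0⦌ n.unop i).op s =
      ComposableArrows.mk₀ (s.obj i) := ComposableArrows.ext₀ rfl
  exact h.symm.trans (congrArg (ψ.app (op ⦋0⦌)) e)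

/-- Maps from the nerve to a constant simplicial set correspond to functions on objects that
identify the source and the target of every morphism. -/
def nerveHomEquiv (X : Type u) : (nerve A ⟶ (Functor.const SimplexCategoryᵒᵖ).obj X) ≃
    {q : A → X // ∀ a b : A, (a ⟶ b) → q a = q b} where
  toFun ψ := ⟨fun a => ψ.app (op ⦋0⦌) (ComposableArrows.mk₀ a), fun a b f =>
    (nerveHom_app X ψ (n := op ⦋1⦌) (ComposableArrows.mk₁ f) 0).symm.trans
      (nerveHom_app X ψ (n := op ⦋1⦌) (ComposableArrows.mk₁ f) 1)⟩
  invFun q :=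
    { app n := ↾fun s : ComposableArrows A n.unop.len => q.1 (s.obj 0)
      naturality n m f := by
        ext s
        let s' : ComposableArrows A n.unop.len := s
        -- The initial vertex of the pulled back simplex is a later vertex of `s`, and the chain `s`
        -- contains a morphism to it from vertex `0`.
        exact (q.2 _ _ (s'.map (homOfLE (Fin.zero_le (f.unop.toOrderHom 0))))).symm }
  left_inv ψ := by
    ext n s
    exact (nerveHom_app X ψ s 0).symm
  right_inv q := rfl

/-- A discrete space with two points. -/
abbrev twoPoints : TopCat.{u} := TopCat.of (ULift.{u} Bool)

/-- Continuous maps from the classifying space to a discrete space with two points correspond to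
functions on objects that identify the source and the target of every morphism. -/
noncomputable def realizationEquiv (A : Type u) [SmallCategory A] :
    (SSet.toTop.obj (nerve A) ⟶ twoPoints.{u}) ≃
      {q : A → ULift.{u} Bool // ∀ a b : A, (a ⟶ b) → q a = q b} :=
  ((sSetTopAdj.homEquiv (nerve A) twoPoints).trans
    (TopCat.toSSetIsoConst twoPoints).homToEquiv).trans (nerveHomEquiv _)

/-- Naturality of `realizationEquiv`: precomposition with the map of classifying spaces becomes
precomposition with `F` on objects. -/
theorem realizationEquiv_comp (F : A ⥤ B) (p : SSet.toTop.obj (nerve B) ⟶ twoPoints.{u}) (a : A) :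
    (realizationEquiv A (SSet.toTop.map (nerveMap F) ≫ p)).1 a =
      (realizationEquiv B p).1 (F.obj a) := by
  simp only [realizationEquiv, Equiv.trans_apply, Adjunction.homEquiv_naturality_left,
    Iso.homToEquiv_apply, Category.assoc]
  change ((sSetTopAdj.homEquiv _ _ p ≫ (TopCat.toSSetIsoConst twoPoints).hom).app (op ⦋0⦌))
    ((nerveMap F).app (op ⦋0⦌) (ComposableArrows.mk₀ a)) = _
  rw [nerveMap_app_mk₀]
  rfl

/-- A homotopy moves each point along a path, and paths in a discrete space are constant. -/
theorem eq_of_homotopic {X Y : Type*} [TopologicalSpace X] [TopologicalSpace Y]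
    [DiscreteTopology Y] {f g : C(X, Y)} (h : f.Homotopic g) : f = g := by
  obtain ⟨H⟩ := h
  ext x
  have hc : Continuous fun t : unitInterval => H (t, x) := by fun_prop
  have := PreconnectedSpace.constant inferInstance hc (x := 0) (y := 1)
  simpa using this

/-- A homotopy equivalence acts bijectively on homotopy classes of maps, and for a discrete target
these are the maps themselves. -/
theorem IsWeakHomotopyEquivalence.bijective_comp {F : A ⥤ B} (h : IsWeakHomotopyEquivalence F) :
    Function.Bijective fun p : SSet.toTop.obj (nerve B) ⟶ twoPoints.{u} =>
      SSet.toTop.map (nerveMap F) ≫ p := by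
  obtain ⟨e, he⟩ := h
  constructor
  · intro p p' hp
    have h1 : p.hom.comp e.toFun = p'.hom.comp e.toFun := by
      rw [he]
      exact congrArg TopCat.Hom.hom hp
    have h2 (p : SSet.toTop.obj (nerve B) ⟶ twoPoints.{u}) :
        p.hom = (p.hom.comp e.toFun).comp e.invFun := by
      rw [ContinuousMap.comp_assoc]
      exact (eq_of_homotopic ((ContinuousMap.Homotopic.refl p.hom).comp e.right_inv)).symm
    exact TopCat.hom_ext (by rw [h2 p, h2 p', h1])
  · intro p
    refine ⟨TopCat.ofHom (p.hom.comp e.invFun), TopCat.hom_ext ?_⟩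
    change (p.hom.comp e.invFun).comp (SSet.toTop.map (nerveMap F)).hom = p.hom
    rw [← he, ContinuousMap.comp_assoc]
    exact eq_of_homotopic ((ContinuousMap.Homotopic.refl p.hom).comp e.left_inv)

/-- The indicator function of the components that meet the image of `F` and the constant function
`true` agree after restriction along `F`, so they are equal by injectivity of restriction. -/
theorem IsWeakHomotopyEquivalence.exists_zigzag {F : A ⥤ B} (h : IsWeakHomotopyEquivalence F)
    (b : B) : ∃ a, Zigzag (F.obj a) b := by
  classical
  let q : {q : B → ULift.{u} Bool // ∀ a b : B, (a ⟶ b) → q a = q b} :=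
    ⟨fun b => ⟨decide (∃ a, Zigzag (F.obj a) b)⟩, fun b b' f =>
      congrArg ULift.up (decide_eq_decide.mpr (exists_congr fun a =>
        ⟨fun z => z.trans (Zigzag.of_hom f), fun z => z.trans (Zigzag.of_inv f)⟩))⟩
  let q' : {q : B → ULift.{u} Bool // ∀ a b : B, (a ⟶ b) → q a = q b} :=
    ⟨fun _ => ⟨true⟩, fun _ _ _ => rfl⟩
  have key : (realizationEquiv B).symm q = (realizationEquiv B).symm q' := by
    refine h.bijective_comp.injective ((realizationEquiv A).injective
      (Subtype.ext (funext fun a => ?_)))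
    rw [realizationEquiv_comp, realizationEquiv_comp, Equiv.apply_symm_apply,
      Equiv.apply_symm_apply]
    exact congrArg ULift.up (decide_eq_true ⟨a, Zigzag.refl _⟩)
  have h1 := congrArg (fun q => (q.1 b).down) ((realizationEquiv B).symm.injective key)
  exact of_decide_eq_true h1

/-- By surjectivity of restriction, the indicator function of the component of `a` comes from a
function on `B`, which cannot separate `F.obj a` from `F.obj a'`. -/
theorem IsWeakHomotopyEquivalence.zigzag {F : A ⥤ B} (h : IsWeakHomotopyEquivalence F)
    {a a' : A} (z : Zigzag (F.obj a) (F.obj a')) : Zigzag a a' := by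
  classical
  let q : {q : A → ULift.{u} Bool // ∀ a b : A, (a ⟶ b) → q a = q b} :=
    ⟨fun b => ⟨decide (Zigzag a b)⟩, fun b b' f =>
      congrArg ULift.up (decide_eq_decide.mpr
        ⟨fun z => z.trans (Zigzag.of_hom f), fun z => z.trans (Zigzag.of_inv f)⟩)⟩
  obtain ⟨p, hp⟩ := h.bijective_comp.surjective ((realizationEquiv A).symm q)
  have h1 (x : A) : (realizationEquiv B p).1 (F.obj x) = q.1 x := by
    rw [← realizationEquiv_comp]
    change (realizationEquiv A ((fun p => SSet.toTop.map (nerveMap F) ≫ p) p)).1 x = _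
    rw [hp, Equiv.apply_symm_apply]
  have h2 : q.1 a = q.1 a' := by
    rw [← h1, ← h1]
    exact eq_of_zigzag _ (fun f => (realizationEquiv B p).2 _ _ f) z
  have h3 : decide (Zigzag a a) = decide (Zigzag a a') := congrArg ULift.down h2
  exact of_decide_eq_true (h3.symm.trans (decide_eq_true (Zigzag.refl a)))

/-- The functor that sends a parsummable category to the path components of its fixed points. -/
def fixedPi0Functor (G : UniversalSubgroup) : ParSumCat.{u} ⥤ Type u where
  obj C := C.FixedPi0 G
  map F := ↾Quotient.map (F.2.fixed G.group).obj fun _ _ z => zigzag_obj_of_zigzag _ z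
  map_id C := by
    ext x
    obtain ⟨X, rfl⟩ := Quotient.exists_rep x
    rfl
  map_comp F F' := by
    ext x
    obtain ⟨X, rfl⟩ := Quotient.exists_rep x
    rfl

theorem isInvertedBy_fixedPi0Functor (G : UniversalSubgroup) :
    globalWeakEquivalences.{u}.IsInvertedBy (fixedPi0Functor G) := by
  intro C C' F hF
  rw [isIso_iff_bijective]
  constructor
  · intro x y h
    obtain ⟨X, rfl⟩ := Quotient.exists_rep x
    obtain ⟨Y, rfl⟩ := Quotient.exists_rep y
    exact Quotient.sound ((hF G).zigzag (Quotient.exact h))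
  · intro y
    obtain ⟨Y, rfl⟩ := Quotient.exists_rep y
    obtain ⟨X, z⟩ := (hF G).exists_zigzag Y
    exact ⟨Quotient.mk'' X, Quotient.sound z⟩

/-- Path components of fixed points are invariants of objects of the localization. -/
theorem nonempty_fixedPi0_equiv (G : UniversalSubgroup) {C C' : ParSumCat.{u}}
    (e : globalWeakEquivalences.Q.obj C ≅ globalWeakEquivalences.Q.obj C') :
    Nonempty (C.FixedPi0 G ≃ C'.FixedPi0 G) :=
  ⟨((Localization.Construction.lift _ (isInvertedBy_fixedPi0Functor G)).mapIso e).toEquiv⟩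

end Components

/-! ### A parsummable category that does not come from a permutative category -/

/-- Finite multisets of unordered pairs of elements of `ω`. -/
@[ext]
structure PairSum : Type u where
  pairs : Multiset (Sym2 Omega)

namespace PairSum

/-- All sets of morphisms are copies of `ZMod 2`. -/
@[ext]
structure Hom (X Y : PairSum.{u}) : Type u where
  val : ZMod 2

instance : SmallCategory PairSum.{u} where
  Hom X Y := Hom X Y
  id _ := ⟨0⟩
  comp f g := ⟨f.val + g.val⟩
  id_comp _ := Hom.ext (zero_add _)
  comp_id _ := Hom.ext (add_zero _)
  assoc _ _ _ := Hom.ext (add_assoc _ _ _)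

theorem hom_ext {X Y : PairSum.{u}} {f g : X ⟶ Y} (h : f.val = g.val) : f = g := Hom.ext h

theorem comp_val {X Y Z : PairSum.{u}} (f : X ⟶ Y) (g : Y ⟶ Z) :
    (f ≫ g).val = f.val + g.val := rfl

theorem id_val (X : PairSum.{u}) : Hom.val (𝟙 X) = 0 := rfl

theorem eqToHom_val {X Y : PairSum.{u}} (h : X = Y) : (eqToHom h).val = 0 := by
  subst h; rfl

theorem map_smul_mul (a b : M) (p : Sym2 Omega) :
    Sym2.map (fun i => (a * b) • i) p = Sym2.map (fun i => a • i) (Sym2.map (fun i => b • i) p) := by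
  rw [Sym2.map_map]; rfl

instance : MulAction M PairSum.{u} where
  smul a X := ⟨X.pairs.map (Sym2.map fun i => a • i)⟩
  one_smul X := PairSum.ext (by
    change X.pairs.map (Sym2.map id) = X.pairs
    rw [Sym2.map_id, Multiset.map_id])
  mul_smul a b X := PairSum.ext (by
    change X.pairs.map _ = (X.pairs.map _).map _
    rw [Multiset.map_map]
    exact Multiset.map_congr rfl fun p _ => map_smul_mul a b p)

theorem smul_pairs (a : M) (X : PairSum.{u}) :
    (a • X).pairs = X.pairs.map (Sym2.map fun i => a • i) := rfl

/-- This is `1` if `a` reverses the order of the two elements of a pair, and `0` otherwise. -/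
def inversion (a : M) : Sym2 Omega → ZMod 2 :=
  Sym2.lift ⟨fun i j => if i < j ↔ a • i < a • j then 0 else 1, fun i j => by
    rcases eq_or_ne i j with rfl | h
    · rfl
    · have h' : a • i ≠ a • j := fun e => h (a.injective e)
      refine if_congr ?_ rfl rfl
      rw [← not_le, ← not_le, not_iff_not, le_iff_lt_or_eq, le_iff_lt_or_eq, or_iff_left h.symm,
        or_iff_left h'.symm]⟩

theorem inversion_mk (a : M) (i j : Omega) :
    inversion a s(i, j) = if i < j ↔ a • i < a • j then 0 else 1 := rfl

/-- A composite reverses a pair exactly when one, but not both, of the two steps does. This cocycle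
identity is the source of `circ_mul`; on degenerate pairs all terms are zero. -/
theorem inversion_mul (a b : M) (p : Sym2 Omega) :
    inversion (a * b) p = inversion b p + inversion a (Sym2.map (fun i => b • i) p) := by
  induction p with
  | _ i j =>
    rw [Sym2.map_mk, inversion_mk, inversion_mk, inversion_mk, mul_smul, mul_smul]
    by_cases h1 : i < j <;> by_cases h2 : b • i < b • j <;> by_cases h3 : a • b • i < a • b • j <;>
      simp [h1, h2, h3] <;> decide

/-- The number, modulo two, of pairs whose order is reversed. -/
def sign (a : M) (X : PairSum.{u}) : ZMod 2 := (X.pairs.map (inversion a)).sum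

theorem sign_mul (a b : M) (X : PairSum.{u}) :
    sign (a * b) X = sign b X + sign a (b • X) := by
  rw [sign, sign, sign, smul_pairs, Multiset.map_map, ← Multiset.sum_map_add]
  exact congrArg Multiset.sum (Multiset.map_congr rfl fun p _ => inversion_mul a b p)

/-- The parity twists the structure isomorphisms. Each is its own inverse because morphisms compose
by addition in characteristic two. -/
instance : EMCat PairSum.{u} where
  circ a X :=
    { hom := ⟨sign a X⟩
      inv := ⟨sign a X⟩
      hom_inv_id := hom_ext (CharTwo.add_self_eq_zero _)
      inv_hom_id := hom_ext (CharTwo.add_self_eq_zero _) }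
  circ_mul a b X := hom_ext (by
    simp only [comp_val, eqToHom_val, add_zero, sign_mul])

theorem circ_val (a : M) (X : PairSum.{u}) : (circ a X).hom.val = sign a X := rfl

/-- Addition of multisets is defined everywhere and the parity is additive, so the axioms reduce to
those of addition in multisets and in `ZMod 2`. -/
instance : Parsummable PairSum.{u} where
  tame X := by
    classical
    refine ⟨X.pairs.toFinset.biUnion Sym2.toFinset, fun a ha => PairSum.ext ?_⟩
    rw [smul_pairs]
    refine (Multiset.map_congr rfl fun p hp => ?_).trans (Multiset.map_id _)
    refine (Sym2.map_congr fun i hi => ha i ?_).trans (congrFun Sym2.map_id p)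
    rw [Finset.mem_biUnion]
    exact ⟨p, Multiset.mem_toFinset.mpr hp, Sym2.mem_toFinset.mpr hi⟩
  zero := ⟨0⟩
  smul_zero _ := rfl
  add X Y _ := ⟨X.pairs + Y.pairs⟩
  add_zero X _ := PairSum.ext (add_zero X.pairs)
  add_comm X Y _ := PairSum.ext (add_comm X.pairs Y.pairs)
  add_assoc X Y Z _ _ _ _ _ := PairSum.ext (add_assoc X.pairs Y.pairs Z.pairs)
  smul_add a X Y _ _ := PairSum.ext (Multiset.map_add _ X.pairs Y.pairs)
  addHom f g _ _ := ⟨f.val + g.val⟩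
  addHom_id _ _ _ := hom_ext (add_zero (0 : ZMod 2))
  addHom_comp f f' g g' _ _ _ := hom_ext (add_add_add_comm _ _ _ _)
  addHom_zero f _ _ := hom_ext (by simp only [comp_val, eqToHom_val, id_val, zero_add, add_zero])
  addHom_comm f g _ _ := hom_ext (by
    simp only [comp_val, eqToHom_val, zero_add, add_zero]
    exact add_comm _ _)
  addHom_assoc f g k _ _ _ _ _ _ _ _ _ _ := hom_ext (by
    simp only [comp_val, eqToHom_val, zero_add, add_zero]
    exact add_assoc _ _ _)
  circ_add a X Y _ _ := hom_ext (by
    simp only [comp_val, eqToHom_val, add_zero, circ_val, sign, Multiset.map_add,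
      Multiset.sum_add])

/-- The parsummable category of finite multisets of unordered pairs. -/
def cat : ParSumCat.{u} := ⟨PairSum.{u}⟩

/-- All sets of morphisms are inhabited, and fixedness is only a condition at the identity, whose
parity vanishes. -/
theorem subsingleton_fixedPi0 {G : UniversalSubgroup} (hG : G.group = ⊥) :
    Subsingleton (cat.{u}.FixedPi0 G) := by
  -- The cocycle identity at `(1, 1)` reads `s = s + s`.
  have h1 (X : PairSum.{u}) : sign 1 X = 0 := by
    have := sign_mul 1 1 X
    rwa [one_smul, mul_one, left_eq_add] at this
  refine ⟨fun x y => ?_⟩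
  have key (X Y : Fixed G.group PairSum.{u}) : Nonempty (X ⟶ Y) := by
    refine ⟨⟨(⟨0⟩ : Hom X.obj Y.obj), ?_⟩⟩
    rw [Fixed.isFixedHom_iff]
    intro g hg
    rw [hG, Subgroup.mem_bot] at hg
    subst hg
    refine hom_ext ?_
    simp only [comp_val, eqToHom_val, circ_val, add_zero, zero_add]
    exact (h1 Y.obj).trans (h1 X.obj).symm
  obtain ⟨X, rfl⟩ := Quotient.exists_rep x
  obtain ⟨Y, rfl⟩ := Quotient.exists_rep y
  exact FixedPi0.mk_eq_of_hom (C := cat) (key X Y).some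

/-- In the fixedness condition the value of `f` occurs once on each side and cancels, so the parity
at `g` is an invariant of components. -/
theorem sign_eq_of_hom {G : Subgroup Mˣ} {g : Mˣ} (hg : g ∈ G) {X Y : Fixed G PairSum.{u}}
    (f : X ⟶ Y) : sign (g : M) X.obj = sign (g : M) Y.obj := by
  have h := congrArg Hom.val ((Fixed.isFixedHom_iff f.1).mp f.2 g hg)
  simp only [comp_val, eqToHom_val, circ_val, add_zero, zero_add] at h
  rw [add_comm] at h
  exact (add_right_cancel h).symm

/-- As an unordered pair, `{i, σ i}` is fixed by `σ`, yet `σ` reverses its order. Its parity is `1`,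
while that of the empty multiset is `0`. -/
theorem not_subsingleton_fixedPi0 {G : UniversalSubgroup} {σ : Mˣ} (hG : G.group = .zpowers σ)
    {i : Omega} (h : (σ : M) • i ≠ i) (h' : (σ : M) • (σ : M) • i = i) :
    ¬ Subsingleton (cat.{u}.FixedPi0 G) := by
  intro hs
  have hσ : σ ∈ G.group := hG ▸ Subgroup.mem_zpowers σ
  let p : PairSum.{u} := ⟨{s(i, (σ : M) • i)}⟩
  have hp : (σ : M) • p = p := PairSum.ext (by
    rw [smul_pairs, Multiset.map_singleton, Sym2.map_mk, h', Sym2.eq_swap])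
  have hfix : ∀ g ∈ G.group, g • p = p := by
    have : G.group ≤ MulAction.stabilizer Mˣ p := by
      rw [hG, Subgroup.zpowers_le]
      exact hp
    exact fun g hg => this hg
  let X : Fixed G.group PairSum.{u} := ⟨p, fun g hg => hfix g hg⟩
  let Y : Fixed G.group PairSum.{u} := ⟨⟨0⟩, fun _ _ => rfl⟩
  have z : Zigzag X Y := Quotient.exact (hs.elim (FixedPi0.mk (C := cat) X) (FixedPi0.mk (C := cat) Y))
  have key := eq_of_zigzag (C := Fixed G.group PairSum.{u}) (fun Z => sign (σ : M) Z.obj)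
    (fun f => sign_eq_of_hom hσ f) z
  have hY : sign (σ : M) Y.obj = 0 := rfl
  have hX : sign (σ : M) X.obj = 1 := by
    change (Multiset.map (inversion (σ : M)) {s(i, (σ : M) • i)}).sum = 1
    rw [Multiset.map_singleton, Multiset.sum_singleton, inversion_mk, h']
    refine if_neg fun e => ?_
    rcases lt_or_gt_of_ne h with h | h
    · exact h.not_gt (e.mpr h)
    · exact h.not_gt (e.mp h)
  simp only [hX, hY] at key
  exact one_ne_zero key

end PairSum

/-! ### Universal subgroups of order at most two -/

/-- The trivial subgroup is universal. -/
theorem exists_universal_bot : ∃ G : UniversalSubgroup, G.group = ⊥ := by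
  refine ⟨⟨⊥, inferInstance, fun A _ _ => ?_⟩, rfl⟩
  obtain ⟨f⟩ : Nonempty (A ↪ Omega) := by
    obtain ⟨f, hf⟩ := Countable.exists_injective_nat A
    exact ⟨⟨fun a => ⟨f a + 1, Nat.succ_pos _⟩, fun a b h =>
      hf (Nat.succ_injective (congrArg Subtype.val h))⟩⟩
  refine ⟨f, f.injective, fun g a => ?_⟩
  rw [Subsingleton.elim g 1, one_smul, one_smul]

/-- There is a universal subgroup of order two. -/
theorem exists_universal_involution : ∃ (G : UniversalSubgroup) (σ : Mˣ),
    G.group = .zpowers σ ∧ ∃ i : Omega, (σ : M) • i ≠ i ∧ (σ : M) • (σ : M) • i = i := by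
  -- Modelling `ω` as `ℕ × ℕ` with the exchange of coordinates gives infinitely many fixed points,
  -- on the diagonal, and infinitely many free orbits off it.
  obtain ⟨e⟩ : Nonempty (ℕ × ℕ ≃ Omega) := ⟨Nat.pairEquiv.trans Equiv.pnatEquivNat.symm⟩
  let s : Omega → Omega := fun i => e (e.symm i).swap
  have hs (p : ℕ × ℕ) : s (e p) = e p.swap := by simp [s]
  have hss (i : Omega) : s (s i) = i := by simp [s]
  let a : M := ⟨s, Function.LeftInverse.injective hss⟩
  have ha : a * a = 1 := Subtype.ext (funext hss)
  let σ : Mˣ := ⟨a, a, ha, ha⟩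
  have hσ : σ ^ 2 = 1 := Units.ext (by rw [pow_two]; exact ha)
  have hmem (g : Subgroup.zpowers σ) : g = 1 ∨ g = ⟨σ, Subgroup.mem_zpowers σ⟩ := by
    obtain ⟨_, n, rfl⟩ := g
    rcases Int.even_or_odd n with ⟨m, rfl⟩ | ⟨m, rfl⟩
    · left
      refine Subtype.ext ?_
      change σ ^ (m + m) = 1
      rw [← two_mul, zpow_mul]
      simp [hσ]
    · right
      refine Subtype.ext ?_
      change σ ^ (2 * m + 1) = σ
      rw [zpow_add_one, zpow_mul]
      simp [hσ]
  refine ⟨⟨Subgroup.zpowers σ, ?_, fun A _ _ => ?_⟩, σ, rfl, e (0, 1), ?_, hss _⟩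
  · exact Finite.of_surjective (fun b : Bool => if b then 1 else ⟨σ, Subgroup.mem_zpowers σ⟩)
      fun g => (hmem g).elim (fun h => ⟨true, h.symm⟩) fun h => ⟨false, h.symm⟩
  · obtain ⟨n, hn⟩ := Countable.exists_injective_nat A
    let τ : Subgroup.zpowers σ := ⟨σ, Subgroup.mem_zpowers σ⟩
    have hτ : τ * τ = 1 := Subtype.ext (by rw [← pow_two] ; exact hσ)
    -- The first coordinate makes the map injective; since `τ` is an involution, applying it to `a`
    -- exchanges the coordinates.
    refine ⟨fun a => e (n a, n (τ • a)), fun a b h => ?_, fun g a => ?_⟩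
    · exact hn (Prod.ext_iff.mp (e.injective h)).1
    · rcases hmem g with rfl | rfl
      · simp only [one_smul]
      · change e (n (τ • a), n (τ • τ • a)) = s (e (n a, n (τ • a)))
        rw [hs, ← mul_smul, hτ, one_smul]
        rfl
  · change s (e (0, 1)) ≠ e (0, 1)
    rw [hs]
    simp

/-- For `Φ D`, triviality of `π₀` of the fixed points passes from the trivial group to `π₀ D` by
injectivity of `a_E`, and from there to every universal `G` by surjectivity of `a_G`. `PairSum.cat`
fails this for a group of order two. -/
theorem exists_not_iso_phi : ∃ C : ParSumCat.{u}, ∀ D : PermCat.{u},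
    IsEmpty (globalWeakEquivalences.Q.obj (Phi D) ≅ globalWeakEquivalences.Q.obj C) := by
  refine ⟨PairSum.cat, fun D => ⟨fun k => ?_⟩⟩
  obtain ⟨E, hE⟩ := exists_universal_bot
  obtain ⟨G, σ, hG, i, h, h'⟩ := exists_universal_involution
  refine PairSum.not_subsingleton_fixedPi0.{u} hG h h' ?_
  obtain ⟨kE⟩ := nonempty_fixedPi0_equiv E k
  obtain ⟨kG⟩ := nonempty_fixedPi0_equiv G k
  have := PairSum.subsingleton_fixedPi0.{u} hE
  have := kE.subsingleton
  obtain ⟨a, ha⟩ := exists_isComparison D E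
  obtain ⟨b, hb⟩ := exists_isComparison D G
  -- Injectivity is applied to constant families, which are then evaluated at the class of an
  -- arbitrary orbit.
  have h1 : Subsingleton D.Pi0 := ⟨fun x y =>
    congrFun (ha.injective hE (Subsingleton.elim (a fun _ => x) (a fun _ => y)))
      (Quotient.mk _ (orbitSet E 1))⟩
  have := hb.surjective.subsingleton
  exact kG.symm.subsingleton

end ParSum

theorem mainTheorem6 :
    -- there is no permutative category with the given monoids of path components
    (¬ ∃ (D : ParSum.PermCat.{u}) (G : ParSum.UniversalSubgroup),
      Nonempty (G.group ≃* Multiplicative (ZMod 3)) ∧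
      Nonempty ((ParSum.Phi D).Pi0 ≃+ ℕ) ∧
      Nonempty ((ParSum.Phi D).FixedPi0 G ≃+ (Fin 3 → ℕ))) ∧
    -- the homomorphisms `a_G` exist, are unique, are surjective, and bijective for the trivial group
    (∀ (D : ParSum.PermCat.{u}) (G : ParSum.UniversalSubgroup),
      (∃! a : (ParSum.TransitiveClass G → D.Pi0) →+ (ParSum.Phi D).FixedPi0 G,
        ParSum.IsComparison a) ∧
      ∀ a : (ParSum.TransitiveClass G → D.Pi0) →+ (ParSum.Phi D).FixedPi0 G,
        ParSum.IsComparison a →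
          Function.Surjective a ∧ (G.group = ⊥ → Function.Bijective a)) ∧
    -- not every object of the localization is isomorphic to the image of some `Φ D`
    (∃ C : ParSum.ParSumCat.{u}, ∀ D : ParSum.PermCat.{u},
      IsEmpty (ParSum.globalWeakEquivalences.Q.obj (ParSum.Phi D) ≅
        ParSum.globalWeakEquivalences.Q.obj C)) := by
  refine ⟨ParSum.not_exists_permCat, fun D G => ⟨?_, fun a ha =>
    ⟨ha.surjective, fun hG => ⟨ha.injective hG, ha.surjective⟩⟩⟩, ParSum.exists_not_iso_phi⟩
  obtain ⟨a, ha⟩ := ParSum.exists_isComparison D G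
  exact ⟨a, ha, fun b hb => hb.unique ha⟩
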